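/- Let $n\ge 1$, let $\mathfrak{sp}_{2n}=\mathfrak n^+\oplus\mathfrak h\oplus\mathfrak n^-$ be a Cartan decomposition of the complex symplectic Lie algebra, and let $\alpha_1,\dots,\alpha_n$ and $\omega_1,\dots,\omega_n$ be the simple roots (with $\alpha_n$ the long one) and the fundamental weights. Consider the ordered alphabet $$J=\{1<2<\dots<n<\overline{n-1}<\dots<\overline 1\},\qquad \overline n:=n.$$ The positive roots are $\alpha_{i,j}=\alpha_i+\dots+\alpha_j$ and $\alpha_{i,\overline j}=\alpha_i+\dots+\alpha_n+\alpha_{n-1}+\dots+\alpha_j$ for $1\le i\le j\le n$, where $\alpha_{i,\overline n}=\alpha_{i,n}$; equivalently, they are indexed by the pairs $(i,q)$ with $i\in\{1,\dots,n\}$, $q\in J$, $i\le q\le\overline i$. For each positive root $\alpha$ fix a nonzero root vector $f_\alpha\in\mathfrak n^-$ of weight $-\alpha$. For a multi-exponent $\mathbf s=(s_\alpha)_{\alpha>0}$, $s_\alpha\in\mathbb Z_{\ge0}$, put $f^{\mathbf s}=\prod_{\alpha>0}f_\alpha^{s_\alpha}\in S(\mathfrak n^-)=\mathbb C[f_\alpha\mid\alpha>0]$.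 A (symplectic) Dyck path is a sequence $\mathbf p=(p(0),\dots,p(k))$, $k\ge0$, of positive roots such that $p(0)=\alpha_i$ is simple, $p(k)=\alpha_j$ or $p(k)=\alpha_{j,\overline j}$ for some $i\le j\le n$, and, whenever $p(t)=\alpha_{r,q}$ with $t<k$, the root $p(t+1)$ is $\alpha_{r,q+1}$ or $\alpha_{r+1,q}$ (here $q+1$ is the successor of $q$ in $J$). For $\lambda=m_1\omega_1+\dots+m_n\omega_n$ with $m_1,\dots,m_n\in\mathbb Z_{\ge0}$, let $S(\lambda)$ be the set of multi-exponents $\mathbf s$ such that every Dyck path $\mathbf p$ satisfies $$s_{p(0)}+\dots+s_{p(k)}\le m_i+\dots+m_j\quad\text{if } p(0)=\alpha_i,\ p(k)=\alpha_j,$$ $$s_{p(0)}+\dots+s_{p(k)}\le m_i+\dots+m_n\quad\text{if } p(0)=\alpha_i,\ p(k)=\alpha_{j,\overline j}.$$ Let $V(\lambda)$ be the irreducible $\mathfrak{sp}_{2n}$-module with highest weight $\lambda$ and highest weight vector $v_\lambda$. Put $V(\lambda)_s=\mathrm{span}\{x_1\cdots x_l v_\lambda : x_i\in\mathfrak n^-,\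 l\le s\}$ and $V(\lambda)_{-1}=0$, and let $\mathrm{gr}\,V(\lambda)=\bigoplus_{s\ge0}V(\lambda)_s/V(\lambda)_{s-1}$, with the $S(\mathfrak n^-)$-module structure induced by the action of $\mathfrak n^-$ on $V(\lambda)$; the class of $v_\lambda$ in $V(\lambda)_0$ is again denoted by $v_\lambda$. The algebra $U(\mathfrak n^+)$ acts on $S(\mathfrak n^-)$, by an action denoted $\circ$, through the derivations induced by the adjoint action of $\mathfrak n^+$ on $\mathfrak n^-\cong\mathfrak{sp}_{2n}/(\mathfrak h\oplus\mathfrak n^+)$. Let $I(\lambda)=S(\mathfrak n^-)\,(U(\mathfrak n^+)\circ R)$ be the ideal of $S(\mathfrak n^-)$ generated by $U(\mathfrak n^+)\circ R$, where $$R=\mathrm{span}\{f_{\alpha_{i,j}}^{m_i+\dots+m_j+1},\ 1\le i\le j\le n-1;\quad f_{\alpha_{i,\overline i}}^{m_i+\dots+m_n+1},\ 1\le i\le n\}.$$ Then: (i) For every $\lambda$ as above, the vectors $f^{\mathbf s}v_\lambda$, $\mathbf s\in S(\lambda)$, span $\mathrm{gr}\,V(\lambda)$. (ii) There is a monomial order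 $\succ$ on $S(\mathfrak n^-)=\mathbb C[f_\alpha\mid\alpha>0]$ such that for every $\lambda$ as above and every multi-exponent $\mathbf s\notin S(\lambda)$ there is a homogeneous straightening law $$f^{\mathbf s}-\sum_{\mathbf s\succ\mathbf t}c_{\mathbf t}f^{\mathbf t}\in I(\lambda),$$ that is, a finite sum with $c_{\mathbf t}\in\mathbb C$, in which all $f^{\mathbf t}$ with $c_{\mathbf t}\ne0$ have the same total degree as $f^{\mathbf s}$. -/

import Mathlib

open scoped DirectSum

attribute [local instance 100] LieRing.ofAssociativeRing

noncomputable section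

namespace SymplecticPBW

/-! ### The Lie algebra `sp_{2n}` and its triangular decomposition -/

/-- The complex symplectic Lie algebra `sp_{2n}`: the block matrices `(A, B; C, -Aᵀ)` with `B` and
`C` symmetric. -/
abbrev Sp (n : ℕ) : Type := ↥(LieAlgebra.Symplectic.sp (Fin n) ℂ)

/-- The position of a row or column index of a `2n × 2n` matrix in the order
`1 < 2 < ... < n < n' < ... < 2' < 1'` of the basis, where the unprimed indices are the ones in the
first block. The set of positive roots below consists of the weights of the matrices in `sp_{2n}`
which are strictly upper triangular for this order. -/
def pos {n : ℕ} : Fin n ⊕ Fin n → ℤ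
  | Sum.inl i => (i : ℤ) - n
  | Sum.inr i => n - (i : ℤ)

theorem mem_sp_iff {n : ℕ} (X : Matrix (Fin n ⊕ Fin n) (Fin n ⊕ Fin n) ℂ) :
    X ∈ LieAlgebra.Symplectic.sp (Fin n) ℂ ↔
      (∀ i j, X (Sum.inr i) (Sum.inr j) = - X (Sum.inl j) (Sum.inl i)) ∧
      (∀ i j, X (Sum.inl i) (Sum.inr j) = X (Sum.inl j) (Sum.inr i)) ∧
      (∀ i j, X (Sum.inr i) (Sum.inl j) = X (Sum.inr j) (Sum.inl i)) := by
  obtain ⟨A, B, C, D, rfl⟩ : ∃ A B C D, X = Matrix.fromBlocks A B C D :=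
    ⟨_, _, _, _, (Matrix.fromBlocks_toBlocks X).symm⟩
  rw [LieAlgebra.Symplectic.sp, mem_skewAdjointMatricesLieSubalgebra,
    mem_skewAdjointMatricesSubmodule]
  simp only [Matrix.IsSkewAdjoint, Matrix.IsAdjointPair, Matrix.J, Matrix.fromBlocks_transpose,
    Matrix.fromBlocks_neg, Matrix.fromBlocks_multiply, Matrix.fromBlocks_inj]
  simp only [← Matrix.ext_iff, Matrix.mul_zero, Matrix.mul_one, Matrix.mul_neg, Matrix.zero_mul,
    Matrix.one_mul, Matrix.neg_mul, zero_add, add_zero, Matrix.neg_apply, Matrix.transpose_apply,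
    neg_neg, Matrix.fromBlocks_apply₁₁, Matrix.fromBlocks_apply₁₂, Matrix.fromBlocks_apply₂₁,
    Matrix.fromBlocks_apply₂₂]
  constructor
  · rintro ⟨h1, h2, h3, h4⟩
    refine ⟨fun i j => ?_, fun i j => ?_, fun i j => ?_⟩
    · rw [h2 i j]; simp
    · have := h4 j i; simpa using this
    · have := h1 j i; simpa using this
  · rintro ⟨h1, h2, h3⟩
    refine ⟨fun i j => ?_, fun i j => ?_, fun i j => ?_, fun i j => ?_⟩
    · simpa using h3 j i
    · simp [h1]
    · simp [h1]
    · simp [h2 i j]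

/-- The subalgebra `n⁺` of strictly upper triangular matrices in `sp_{2n}`. -/
def nPlus (n : ℕ) : LieSubalgebra ℂ (Sp n) where
  carrier := {X | ∀ a b, pos b ≤ pos a → X.1 a b = 0}
  zero_mem' := fun a b _ => rfl
  add_mem' := fun {X Y} hX hY a b h => by
    change X.1 a b + Y.1 a b = 0
    rw [hX a b h, hY a b h, add_zero]
  smul_mem' := fun c X hX a b h => by
    change c * X.1 a b = 0
    rw [hX a b h, mul_zero]
  lie_mem' := fun {X Y} hX hY a b h => by
    change (X.1 * Y.1 - Y.1 * X.1) a b = 0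
    rw [Matrix.sub_apply, Matrix.mul_apply, Matrix.mul_apply, Finset.sum_eq_zero,
      Finset.sum_eq_zero, sub_zero]
    all_goals
      intro k _
      by_cases hk : pos k ≤ pos a
      · first | rw [hX a k hk, zero_mul] | rw [hY a k hk, zero_mul]
      · first | rw [hY k b (by omega), mul_zero] | rw [hX k b (by omega), mul_zero]

/-- The subalgebra `n⁻` of strictly lower triangular matrices in `sp_{2n}`. -/
def nMinus (n : ℕ) : LieSubalgebra ℂ (Sp n) where
  carrier := {X | ∀ a b, pos a ≤ pos b → X.1 a b = 0}
  zero_mem' := fun a b _ => rfl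
  add_mem' := fun {X Y} hX hY a b h => by
    change X.1 a b + Y.1 a b = 0
    rw [hX a b h, hY a b h, add_zero]
  smul_mem' := fun c X hX a b h => by
    change c * X.1 a b = 0
    rw [hX a b h, mul_zero]
  lie_mem' := fun {X Y} hX hY a b h => by
    change (X.1 * Y.1 - Y.1 * X.1) a b = 0
    rw [Matrix.sub_apply, Matrix.mul_apply, Matrix.mul_apply, Finset.sum_eq_zero,
      Finset.sum_eq_zero, sub_zero]
    all_goals
      intro k _
      by_cases hk : pos a ≤ pos k
      · first | rw [hX a k hk, zero_mul] | rw [hY a k hk, zero_mul]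
      · first | rw [hY k b (by omega), mul_zero] | rw [hX k b (by omega), mul_zero]

/-- The Cartan subalgebra `h` of diagonal matrices in `sp_{2n}`. -/
def cartan (n : ℕ) : Submodule ℂ (Sp n) where
  carrier := {X | ∀ a b, a ≠ b → X.1 a b = 0}
  zero_mem' := fun a b _ => rfl
  add_mem' := fun {X Y} hX hY a b h => by
    change X.1 a b + Y.1 a b = 0
    rw [hX a b h, hY a b h, add_zero]
  smul_mem' := fun c X hX a b h => by
    change c * X.1 a b = 0
    rw [hX a b h, mul_zero]

/-! ### Roots and weights -/

/-- The functional `ε_k`, reading the `k`-th diagonal entry. -/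
def eps {n : ℕ} (k : Fin n) : Sp n →ₗ[ℂ] ℂ where
  toFun H := H.1 (Sum.inl k) (Sum.inl k)
  map_add' _ _ := rfl
  map_smul' _ _ := rfl

/-- The simple roots `α_k = ε_k - ε_{k+1}` for `k < n` and `α_n = 2 ε_n`
(the index `k` is shifted by one). -/
def simpleRoot {n : ℕ} (k : Fin n) : Sp n →ₗ[ℂ] ℂ :=
  if h : (k : ℕ) + 1 < n then eps k - eps ⟨k + 1, h⟩ else (2 : ℂ) • eps k

/-- The fundamental weights `ω_k = ε_1 + ... + ε_k` (the index `k` is shifted by one). -/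
def fundWeight {n : ℕ} (k : Fin n) : Sp n →ₗ[ℂ] ℂ := ∑ l ∈ Finset.Iic k, eps l

/-- The weight `λ = m_1 ω_1 + ... + m_n ω_n`. -/
def weight {n : ℕ} (m : Fin n → ℕ) : Sp n →ₗ[ℂ] ℂ := ∑ k, m k • fundWeight k

/-- The alphabet `J = {1 < 2 < ... < n < \bar{n-1} < ... < \bar 1}`: the letter `j ≤ n` is
the element `j - 1` of `Fin (2n - 1)`, the letter `\bar j` is the element `2n - 1 - j`. -/
abbrev J (n : ℕ) : Type := Fin (2 * n - 1)

/-- The map `J → {1, ..., n}` with `j ↦ j` and `\bar j ↦ j` (all indices shifted by one). -/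
def absJ {n : ℕ} (q : J n) : Fin n :=
  if h : (q : ℕ) < n then ⟨q, h⟩ else ⟨2 * n - 2 - q, by have := q.2; omega⟩

/-- The index set of the positive roots: the pairs `(i, q)` with `i ∈ {1, ..., n}`, `q ∈ J` and
`i ≤ q ≤ \bar i`. The pair `(i, j)` stands for `α_{i,j}`, the pair `(i, \bar j)` for
`α_{i,\bar j}`. -/
abbrev PosRoot (n : ℕ) : Type :=
  {p : Fin n × J n // (p.1 : ℕ) ≤ (p.2 : ℕ) ∧ (p.1 : ℕ) + (p.2 : ℕ) ≤ 2 * n - 2}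

/-- The positive roots `α_{i,j} = α_i + ... + α_j` and
`α_{i,\bar j} = α_i + ... + α_n + α_{n-1} + ... + α_j`. -/
def PosRoot.root {n : ℕ} (α : PosRoot n) : Sp n →ₗ[ℂ] ℂ :=
  ∑ k ∈ Finset.univ.filter (fun k : J n => (α.1.1 : ℕ) ≤ (k : ℕ) ∧ k ≤ α.1.2), simpleRoot (absJ k)

/-- `α` is the simple root `α_j = α_{j,j}`. -/
def IsSimple {n : ℕ} (α : PosRoot n) (j : Fin n) : Prop :=
  α.1.1 = j ∧ (α.1.2 : ℕ) = j

/-- `α` is the root `α_{j,\bar j}`; this includes `α_{n,\bar n} = α_n`. -/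
def IsLong {n : ℕ} (α : PosRoot n) (j : Fin n) : Prop :=
  α.1.1 = j ∧ (j : ℕ) + (α.1.2 : ℕ) = 2 * n - 2

/-- A choice of a nonzero root vector `f_α` in the root space of weight `-α`, for all positive
roots `α`. -/
structure IsRootVectors {n : ℕ} (f : PosRoot n → nMinus n) : Prop where
  ne_zero : ∀ α, f α ≠ 0
  lie_eq : ∀ α, ∀ H ∈ cartan n, ⁅H, (f α : Sp n)⁆ = -(α.root H) • (f α : Sp n)

/-! ### Dyck paths and the polytope -/

/-- One step of a Dyck path: from `α_{r,q}` to `α_{r,q+1}` or to `α_{r+1,q}`. -/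
def Step {n : ℕ} (α β : PosRoot n) : Prop :=
  (β.1.1 = α.1.1 ∧ (β.1.2 : ℕ) = α.1.2 + 1) ∨ ((β.1.1 : ℕ) = α.1.1 + 1 ∧ β.1.2 = α.1.2)

/-- `p(0), ..., p(k)` is a symplectic Dyck path. -/
structure IsDyckPath {n k : ℕ} (p : Fin (k + 1) → PosRoot n) : Prop where
  head : ∃ i, IsSimple (p 0) i
  last : ∃ j, IsSimple (p (Fin.last k)) j ∨ IsLong (p (Fin.last k)) j
  step : ∀ t : Fin k, Step (p t.castSucc) (p t.succ)

/-- The polytope `P(λ)` for `λ = m_1 ω_1 + ... + m_n ω_n`. -/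
def polytope {n : ℕ} (m : Fin n → ℕ) : Set (PosRoot n → ℝ) :=
  {s | (∀ α, 0 ≤ s α) ∧ ∀ (k : ℕ) (p : Fin (k + 1) → PosRoot n), IsDyckPath p →
    ∀ i j : Fin n, IsSimple (p 0) i →
      (IsSimple (p (Fin.last k)) j → ∑ t, s (p t) ≤ ∑ l ∈ Finset.Icc i j, (m l : ℝ)) ∧
      (IsLong (p (Fin.last k)) j → ∑ t, s (p t) ≤ ∑ l ∈ Finset.Ici i, (m l : ℝ))}

/-- The set `S(λ)` of integral points of `P(λ)`, as a set of multi-exponents. -/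
def latticePoints {n : ℕ} (m : Fin n → ℕ) : Set (PosRoot n →₀ ℕ) :=
  {s | (fun α => (s α : ℝ)) ∈ polytope m}

/-! ### The symmetric algebra of `n⁻` and the action of `U(n⁺)` on it -/

/-- The symmetric algebra `S(n⁻)`. -/
abbrev SymMinus (n : ℕ) : Type := SymmetricAlgebra ℂ (nMinus n)

/-- The monomial `f^s = ∏ f_α^{s_α}` in `S(n⁻)`. -/
def mon {n : ℕ} (f : PosRoot n → nMinus n) (s : PosRoot n →₀ ℕ) : SymMinus n :=
  s.prod fun α k => SymmetricAlgebra.ι ℂ (nMinus n) (f α) ^ k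

/-- The projection `sp_{2n} → n⁻` along `h ⊕ n⁺`. -/
def projMinus (n : ℕ) : Sp n →ₗ[ℂ] nMinus n where
  toFun X := ⟨⟨Matrix.of fun a b => if pos b < pos a then X.1 a b else 0, by
    obtain ⟨h1, h2, h3⟩ := (mem_sp_iff X.1).1 X.2
    rw [mem_sp_iff]
    refine ⟨fun i j => ?_, fun i j => ?_, fun i j => ?_⟩
    · have e : pos (n := n) (Sum.inr j) < pos (n := n) (Sum.inr i) ↔ pos (n := n) (Sum.inl i) < pos (n := n) (Sum.inl j) := by
        simp only [pos]; omega
      simp only [Matrix.of_apply, h1 i j]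
      by_cases h : pos (n := n) (Sum.inr j) < pos (n := n) (Sum.inr i)
      · rw [if_pos h, if_pos (e.1 h)]
      · rw [if_neg h, if_neg (mt e.2 h)]; exact neg_zero.symm
    · have e : pos (n := n) (Sum.inr j) < pos (n := n) (Sum.inl i) ↔ pos (n := n) (Sum.inr i) < pos (n := n) (Sum.inl j) := by
        simp only [pos]; omega
      simp only [Matrix.of_apply, h2 i j]
      by_cases h : pos (n := n) (Sum.inr j) < pos (n := n) (Sum.inl i)
      · rw [if_pos h, if_pos (e.1 h)]
      · rw [if_neg h, if_neg (mt e.2 h)]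
    · have e : pos (n := n) (Sum.inl j) < pos (n := n) (Sum.inr i) ↔ pos (n := n) (Sum.inl i) < pos (n := n) (Sum.inr j) := by
        simp only [pos]; omega
      simp only [Matrix.of_apply, h3 i j]
      by_cases h : pos (n := n) (Sum.inl j) < pos (n := n) (Sum.inr i)
      · rw [if_pos h, if_pos (e.1 h)]
      · rw [if_neg h, if_neg (mt e.2 h)]⟩, fun a b h => if_neg (not_lt.2 h)⟩
  map_add' X Y := by
    ext a b
    change (if pos b < pos a then X.1 a b + Y.1 a b else 0) =
      (if pos b < pos a then X.1 a b else 0) + (if pos b < pos a then Y.1 a b else 0)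
    split_ifs <;> simp
  map_smul' c X := by
    ext a b
    change (if pos b < pos a then c * X.1 a b else 0) =
      c * (if pos b < pos a then X.1 a b else 0)
    split_ifs <;> simp

theorem projMinus_apply {n : ℕ} (X : Sp n) (a b : Fin n ⊕ Fin n) :
    (projMinus n X).1.1 a b = if pos b < pos a then X.1 a b else 0 := rfl

/-- `n⁺` maps the kernel `h ⊕ n⁺` of the projection to itself. -/
theorem projMinus_lie {n : ℕ} (e : nPlus n) (X : Sp n) :
    projMinus n ⁅(e : Sp n), (projMinus n X : Sp n)⁆ = projMinus n ⁅(e : Sp n), X⁆ := by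
  ext a b
  rw [projMinus_apply, projMinus_apply]
  split_ifs with h
  · change (e.1.1 * (projMinus n X).1.1 - (projMinus n X).1.1 * e.1.1) a b =
      (e.1.1 * X.1 - X.1 * e.1.1) a b
    simp only [Matrix.sub_apply, Matrix.mul_apply, projMinus_apply]
    congr 1
    · refine Finset.sum_congr rfl fun k _ => ?_
      split_ifs with hk
      · rfl
      · rw [e.2 a k (by omega), zero_mul, zero_mul]
    · refine Finset.sum_congr rfl fun k _ => ?_
      split_ifs with hk
      · rfl
      · rw [e.2 k b (by omega), mul_zero, mul_zero]
  · rfl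

/-- The action `x ↦ pr([e, x])` of `e ∈ n⁺` on `n⁻ ≅ sp_{2n} / (h ⊕ n⁺)`. -/
def actMinus (n : ℕ) : nPlus n →ₗ⁅ℂ⁆ Module.End ℂ (nMinus n) where
  toFun e := projMinus n ∘ₗ (LieModule.toEnd ℂ (Sp n) (Sp n) (e : Sp n)) ∘ₗ
    (nMinus n).toSubmodule.subtype
  map_add' e e' := by
    ext1 x
    change projMinus n ⁅(e : Sp n) + e', (x : Sp n)⁆ =
      projMinus n ⁅(e : Sp n), (x : Sp n)⁆ + projMinus n ⁅(e' : Sp n), (x : Sp n)⁆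
    rw [add_lie, map_add]
  map_smul' c e := by
    ext1 x
    change projMinus n ⁅c • (e : Sp n), (x : Sp n)⁆ = c • projMinus n ⁅(e : Sp n), (x : Sp n)⁆
    rw [smul_lie, map_smul]
  map_lie' := fun {e e'} => by
    ext1 x
    change projMinus n ⁅⁅(e : Sp n), (e' : Sp n)⁆, (x : Sp n)⁆ =
      projMinus n ⁅(e : Sp n), (projMinus n ⁅(e' : Sp n), (x : Sp n)⁆ : Sp n)⁆ -
      projMinus n ⁅(e' : Sp n), (projMinus n ⁅(e : Sp n), (x : Sp n)⁆ : Sp n)⁆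
    rw [projMinus_lie, projMinus_lie, ← map_sub, lie_lie]

section SymDer

variable {M : Type*} [AddCommGroup M] [Module ℂ M]

/-- The algebra homomorphism `p ↦ p + ε D(p)` into the dual numbers over the symmetric algebra,
where `D` is the derivation which extends `φ`. -/
def symDerAux (φ : Module.End ℂ M) :
    SymmetricAlgebra ℂ M →ₐ[ℂ] DualNumber (SymmetricAlgebra ℂ M) :=
  SymmetricAlgebra.lift
    ((TrivSqZeroExt.inlAlgHom ℂ (SymmetricAlgebra ℂ M) (SymmetricAlgebra ℂ M)).toLinearMap ∘ₗ
        SymmetricAlgebra.ι ℂ M +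
      (TrivSqZeroExt.inrHom (SymmetricAlgebra ℂ M) (SymmetricAlgebra ℂ M)).restrictScalars ℂ ∘ₗ
        SymmetricAlgebra.ι ℂ M ∘ₗ φ)

theorem symDerAux_ι (φ : Module.End ℂ M) (x : M) :
    symDerAux φ (SymmetricAlgebra.ι ℂ M x) =
      TrivSqZeroExt.inl (SymmetricAlgebra.ι ℂ M x) +
        TrivSqZeroExt.inr (SymmetricAlgebra.ι ℂ M (φ x)) := by
  rw [symDerAux, SymmetricAlgebra.lift_ι_apply]
  rfl

theorem symDerAux_fst (φ : Module.End ℂ M) (p : SymmetricAlgebra ℂ M) :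
    (symDerAux φ p).fst = p := by
  have : (TrivSqZeroExt.fstHom ℂ (SymmetricAlgebra ℂ M) (SymmetricAlgebra ℂ M)).comp
      (symDerAux φ) = AlgHom.id ℂ _ := by
    apply SymmetricAlgebra.algHom_ext
    ext x
    change (symDerAux φ (SymmetricAlgebra.ι ℂ M x)).fst = _
    rw [symDerAux_ι]
    simp
  exact DFunLike.congr_fun this p

/-- The derivation of the symmetric algebra `S(M)` which extends a linear endomorphism of `M`. -/
def symDer (φ : Module.End ℂ M) :
    Derivation ℂ (SymmetricAlgebra ℂ M) (SymmetricAlgebra ℂ M) :=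
  Derivation.mk'
    ((TrivSqZeroExt.sndHom (SymmetricAlgebra ℂ M) (SymmetricAlgebra ℂ M)).restrictScalars ℂ ∘ₗ
      (symDerAux φ).toLinearMap) fun p q => by
    change (symDerAux φ (p * q)).snd = p • (symDerAux φ q).snd + q • (symDerAux φ p).snd
    rw [map_mul, TrivSqZeroExt.snd_mul, symDerAux_fst, symDerAux_fst,
      op_smul_eq_smul]

theorem symDer_ι (φ : Module.End ℂ M) (x : M) :
    symDer φ (SymmetricAlgebra.ι ℂ M x) = SymmetricAlgebra.ι ℂ M (φ x) := by
  change (symDerAux φ (SymmetricAlgebra.ι ℂ M x)).snd = _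
  rw [symDerAux_ι]
  simp

theorem symDer_ext (D D' : Derivation ℂ (SymmetricAlgebra ℂ M) (SymmetricAlgebra ℂ M))
    (h : ∀ x, D (SymmetricAlgebra.ι ℂ M x) = D' (SymmetricAlgebra.ι ℂ M x)) : D = D' := by
  ext p
  induction p using SymmetricAlgebra.induction with
  | algebraMap r => simp
  | ι x => exact h x
  | mul a b ha hb => rw [D.leibniz, D'.leibniz, ha, hb]
  | add a b ha hb => rw [map_add, map_add, ha, hb]

end SymDer

/-- The action of the Lie algebra `n⁺` on `S(n⁻)` by derivations which extends its action on
`n⁻ ≅ sp_{2n} / (h ⊕ n⁺)`. -/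
def actSym (n : ℕ) : nPlus n →ₗ⁅ℂ⁆ Module.End ℂ (SymMinus n) where
  toFun e := (symDer (actMinus n e)).toLinearMap
  map_add' e e' := by
    rw [← Derivation.coe_add_linearMap]
    congr 1
    exact symDer_ext _ _ fun x => by simp [symDer_ι]
  map_smul' c e := by
    rw [RingHom.id_apply, ← Derivation.coe_smul_linearMap]
    congr 1
    exact symDer_ext _ _ fun x => by simp [symDer_ι]
  map_lie' := fun {e e'} => by
    have : symDer (actMinus n ⁅e, e'⁆) = ⁅symDer (actMinus n e), symDer (actMinus n e')⁆ :=
      symDer_ext _ _ fun x => by simp [symDer_ι, Derivation.commutator_apply]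
    rw [this]
    rfl

/-- The action `∘` of `U(n⁺)` on `S(n⁻)`. -/
def actU (n : ℕ) : UniversalEnvelopingAlgebra ℂ (nPlus n) →ₐ[ℂ] Module.End ℂ (SymMinus n) :=
  UniversalEnvelopingAlgebra.lift ℂ (actSym n)

/-- The action of `n⁺` on `S(n⁻)` is the one induced from the adjoint action on `S(sp_{2n})` through
the surjection `S(sp_{2n}) → S(n⁻)` whose kernel is generated by `h ⊕ n⁺`. -/
theorem actU_lift_proj {n : ℕ} (e : nPlus n) (p : SymmetricAlgebra ℂ (Sp n)) :
    actU n (UniversalEnvelopingAlgebra.ι ℂ e)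
      (SymmetricAlgebra.lift (SymmetricAlgebra.ι ℂ (nMinus n) ∘ₗ projMinus n) p) =
    SymmetricAlgebra.lift (SymmetricAlgebra.ι ℂ (nMinus n) ∘ₗ projMinus n)
      (symDer (LieModule.toEnd ℂ (Sp n) (Sp n) (e : Sp n)) p) := by
  rw [actU, UniversalEnvelopingAlgebra.lift_ι_apply]
  change symDer (actMinus n e) _ = _
  induction p using SymmetricAlgebra.induction with
  | algebraMap r => simp
  | ι x =>
    simp only [symDer_ι, SymmetricAlgebra.lift_ι_apply, LinearMap.comp_apply]
    exact congrArg _ (projMinus_lie e x)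
  | mul a b ha hb => simp only [map_mul, Derivation.leibniz, map_add, ha, hb, smul_eq_mul]
  | add a b ha hb => simp only [map_add, ha, hb]

/-- The set of powers of root vectors
`f_{α_{i,j}}^{m_i + ... + m_j + 1}`, `1 ≤ i ≤ j ≤ n - 1`, and
`f_{α_{i,\bar i}}^{m_i + ... + m_n + 1}`, `1 ≤ i ≤ n`. -/
def rootPowers {n : ℕ} (f : PosRoot n → nMinus n) (m : Fin n → ℕ) : Set (SymMinus n) :=
  {r | ∃ (α : PosRoot n) (j : Fin n), (j : ℕ) + 1 < n ∧ (α.1.2 : ℕ) = j ∧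
      r = SymmetricAlgebra.ι ℂ (nMinus n) (f α) ^ ((∑ l ∈ Finset.Icc α.1.1 j, m l) + 1)} ∪
  {r | ∃ (α : PosRoot n) (i : Fin n), IsLong α i ∧
      r = SymmetricAlgebra.ι ℂ (nMinus n) (f α) ^ ((∑ l ∈ Finset.Ici i, m l) + 1)}

/-- The ideal `I(λ) = S(n⁻) (U(n⁺) ∘ R)`, where `R` is the linear span of the above powers. -/
def idealI {n : ℕ} (f : PosRoot n → nMinus n) (m : Fin n → ℕ) : Ideal (SymMinus n) :=
  Ideal.span {q | ∃ u, ∃ r ∈ Submodule.span ℂ (rootPowers f m), q = actU n u r}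

/-! ### The PBW filtration and the associated graded module -/

/-- The degree filtration `U(n⁻)_s = span {x_1 ... x_l : l ≤ s}`. -/
def uFilt (n s : ℕ) : Submodule ℂ (UniversalEnvelopingAlgebra ℂ (nMinus n)) :=
  Submodule.span ℂ {u | ∃ l : List (nMinus n), l.length ≤ s ∧
    u = (l.map (UniversalEnvelopingAlgebra.ι ℂ)).prod}

section Graded

variable {n : ℕ} {V : Type*} [AddCommGroup V] [Module ℂ V] [LieRingModule (Sp n) V]
  [LieModule ℂ (Sp n) V]

/-- `V` is an irreducible `sp_{2n}`-module with highest weight `λ = m_1 ω_1 + ... + m_n ω_n` and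
highest weight vector `v`; this determines the pair `(V, v)` up to a unique isomorphism. -/
structure IsIrreducibleHighestWeight (m : Fin n → ℕ) (v : V) : Prop where
  irreducible : LieModule.IsIrreducible ℂ (Sp n) V
  ne_zero : v ≠ 0
  lie_nPlus : ∀ e ∈ nPlus n, ⁅e, v⁆ = 0
  lie_cartan : ∀ H ∈ cartan n, ⁅H, v⁆ = weight m H • v

/-- The PBW filtration `V_s = U(n⁻)_s v`. -/
def filt (n : ℕ) {V : Type*} [AddCommGroup V] [Module ℂ V] [LieRingModule (Sp n) V]
    [LieModule ℂ (Sp n) V] (v : V) (s : ℕ) : Submodule ℂ V :=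
  (uFilt n s).map ((LinearMap.applyₗ v) ∘ₗ
    (UniversalEnvelopingAlgebra.lift ℂ (LieModule.toEnd ℂ (nMinus n) V)).toLinearMap)

/-- The preceding step `V_{s-1}` of the PBW filtration, where `V_{-1} = 0`. -/
def filtPred (n : ℕ) {V : Type*} [AddCommGroup V] [Module ℂ V] [LieRingModule (Sp n) V]
    [LieModule ℂ (Sp n) V] (v : V) : ℕ → Submodule ℂ V
  | 0 => ⊥
  | s + 1 => filt n v s

theorem mem_filt_zero (v : V) : v ∈ filt n v 0 :=
  ⟨1, Submodule.subset_span ⟨[], le_rfl, by simp⟩, by simp⟩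

/-- `n⁻ V_s ⊆ V_{s+1}`. -/
theorem lie_mem_filt (v : V) (s : ℕ) (x : nMinus n) (w : V) (hw : w ∈ filt n v s) :
    ⁅x, w⁆ ∈ filt n v (s + 1) := by
  obtain ⟨u, hu, rfl⟩ := hw
  refine ⟨UniversalEnvelopingAlgebra.ι ℂ x * u, ?_, ?_⟩
  · induction hu using Submodule.span_induction with
    | mem u hu =>
      obtain ⟨l, hl, rfl⟩ := hu
      exact Submodule.subset_span ⟨x :: l, by simpa using hl, by simp⟩
    | zero => rw [mul_zero]; exact zero_mem _
    | add a b _ _ ha hb => rw [mul_add]; exact add_mem ha hb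
    | smul c a _ ha => rw [mul_smul_comm]; exact Submodule.smul_mem _ _ ha
  · simp

theorem lie_mem_filtPred (v : V) (s : ℕ) (x : nMinus n) (w : V) (hw : w ∈ filtPred n v s) :
    ⁅x, w⁆ ∈ filtPred n v (s + 1) := by
  cases s with
  | zero =>
    rw [(Submodule.mem_bot ℂ).1 hw, lie_zero]
    exact zero_mem _
  | succ s => exact lie_mem_filt v s x w hw

/-- The homogeneous component `gr_s V = V_s / V_{s-1}`. -/
abbrev GrPiece (n : ℕ) {V : Type*} [AddCommGroup V] [Module ℂ V] [LieRingModule (Sp n) V]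
    [LieModule ℂ (Sp n) V] (v : V) (s : ℕ) : Type _ :=
  ↥(filt n v s) ⧸ (filtPred n v s).comap (filt n v s).subtype

/-- The associated graded space `gr V = ⨁ V_s / V_{s-1}` of the PBW filtration. -/
abbrev Gr (n : ℕ) {V : Type*} [AddCommGroup V] [Module ℂ V] [LieRingModule (Sp n) V]
    [LieModule ℂ (Sp n) V] (v : V) : Type _ :=
  ⨁ s, GrPiece n v s

/-- The map `V_s → V_{s+1}` given by the action of `x ∈ n⁻`. -/
def filtStep (v : V) (s : ℕ) (x : nMinus n) : filt n v s →ₗ[ℂ] filt n v (s + 1) :=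
  (LieModule.toEnd ℂ (nMinus n) V x).restrict fun w hw => lie_mem_filt v s x w hw

/-- The map `V_s / V_{s-1} → V_{s+1} / V_s` induced by the action of `x ∈ n⁻`. -/
def grStep (v : V) (s : ℕ) (x : nMinus n) : GrPiece n v s →ₗ[ℂ] GrPiece n v (s + 1) :=
  Submodule.mapQ _ _ (filtStep v s x) fun w hw => lie_mem_filtPred v s x w hw

/-- The operator of degree one on `gr V` induced by the action of `x ∈ n⁻`. -/
def grOp (v : V) (x : nMinus n) : Module.End ℂ (Gr n v) :=
  DirectSum.toModule ℂ ℕ (Gr n v) fun s =>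
    DirectSum.lof ℂ ℕ (GrPiece n v) (s + 1) ∘ₗ grStep v s x

theorem grOp_lof_mk (v : V) (x : nMinus n) (s : ℕ) (w : filt n v s) :
    grOp v x (DirectSum.lof ℂ ℕ (GrPiece n v) s (Submodule.Quotient.mk w)) =
      DirectSum.lof ℂ ℕ (GrPiece n v) (s + 1) (Submodule.Quotient.mk (filtStep v s x w)) := by
  rw [grOp, DirectSum.toModule_lof]
  rfl

theorem gr_hom_ext {v : V} {A B : Module.End ℂ (Gr n v)}
    (h : ∀ (s : ℕ) (w : filt n v s),
      A (DirectSum.lof ℂ ℕ (GrPiece n v) s (Submodule.Quotient.mk w)) =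
      B (DirectSum.lof ℂ ℕ (GrPiece n v) s (Submodule.Quotient.mk w))) : A = B := by
  refine DirectSum.linearMap_ext ℂ fun s => LinearMap.ext fun w => ?_
  obtain ⟨w, rfl⟩ := Submodule.Quotient.mk_surjective _ w
  exact h s w

/-- The linear map from `n⁻` to the operators on `gr V`. -/
def grOpLin (v : V) : nMinus n →ₗ[ℂ] Module.End ℂ (Gr n v) where
  toFun x := grOp v x
  map_add' x y := gr_hom_ext fun s w => by
    rw [LinearMap.add_apply, grOp_lof_mk, grOp_lof_mk, grOp_lof_mk, ← map_add,
      ← Submodule.Quotient.mk_add]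
    congr 2
    exact Subtype.ext (add_lie x y (w : V))
  map_smul' c x := gr_hom_ext fun s w => by
    rw [RingHom.id_apply, LinearMap.smul_apply, grOp_lof_mk, grOp_lof_mk, ← map_smul,
      ← Submodule.Quotient.mk_smul]
    congr 2
    exact Subtype.ext (smul_lie c x (w : V))

/-- The induced operators on `gr V` commute, because `[n⁻, n⁻] ⊆ n⁻` raises the filtration degree
by one only. -/
theorem grOpLin_comm (v : V) (x y : nMinus n) :
    grOpLin v x * grOpLin v y = grOpLin v y * grOpLin v x :=
  gr_hom_ext fun s w => by
    rw [Module.End.mul_apply, Module.End.mul_apply]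
    change grOp v x (grOp v y (DirectSum.lof ℂ ℕ (GrPiece n v) s (Submodule.Quotient.mk w))) =
      grOp v y (grOp v x (DirectSum.lof ℂ ℕ (GrPiece n v) s (Submodule.Quotient.mk w)))
    rw [grOp_lof_mk, grOp_lof_mk, grOp_lof_mk, grOp_lof_mk]
    congr 1
    rw [Submodule.Quotient.eq]
    change ⁅x, ⁅y, (w : V)⁆⁆ - ⁅y, ⁅x, (w : V)⁆⁆ ∈ filt n v (s + 1)
    rw [← lie_lie]
    exact lie_mem_filt v s _ _ w.2

/-- The structure of an `S(n⁻)`-module on `gr V` induced by the action of `n⁻` on `V`. -/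
def grAct (v : V) : SymMinus n →ₐ[ℂ] Module.End ℂ (Gr n v) :=
  RingCon.liftₐ _ (TensorAlgebra.lift ℂ (grOpLin v)) (RingCon.ringConGen_le.2 fun p q h => by
    cases h with
    | mul_comm x y =>
      change TensorAlgebra.lift ℂ (grOpLin v) _ = TensorAlgebra.lift ℂ (grOpLin v) _
      rw [map_mul, map_mul, TensorAlgebra.lift_ι_apply, TensorAlgebra.lift_ι_apply,
        grOpLin_comm])

theorem grAct_ι (v : V) (x : nMinus n) :
    grAct v (SymmetricAlgebra.ι ℂ (nMinus n) x) = grOp v x :=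
  TensorAlgebra.lift_ι_apply (grOpLin v) x

/-- The class of the vector `v` in `V_0 ⊆ gr V`. -/
def grTop (v : V) : Gr n v :=
  DirectSum.lof ℂ ℕ (GrPiece n v) 0 (Submodule.Quotient.mk ⟨v, mem_filt_zero v⟩)

end Graded

end SymplecticPBW
end

/-! Write `a*` for `a.swap`. Identify `sp_{2n}` with the symmetric square of `ℂ^{2n}`. Up to a
scalar, a root vector of weight `-α` is a product `x_a x_b` with `pos a + pos b > 0`, and in `n⁻ ≅
sp_{2n} / (h ⊕ n⁺)` all other products vanish. The element `lower v k` of `n⁺` replaces `x_v` by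
`x_k`; its other effect, `x_{k*} ↦ ± x_{v*}`, is invisible on products of vectors not later than `v`
(`actMinus_lower_of_le`). There it acts with nonnegative integer coefficients, so the computation
can be done in polynomials over `ℕ`, where nothing cancels.

Straightening law: suppose `s` violates the inequality of a Dyck path. After dividing by a monomial,
`s` is supported on the path, along which both indices of the roots weakly increase. The ideal
contains a power of `x_{i*} x_{i*}` or of `x_{j+1} x_{i*}` of the degree of `s`. Lowering its
factors gives an element of the ideal in which the monomial of `s` has a nonzero coefficient, and
all of whose monomials use the same multiset of basis vectors (`exists_straightening`). Among
monomials with the same multiset, one supported on a chain is the largest in a lexicographic order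
(`rootLex_lt_of_chain`), so the relation can be solved for it (`hasStraightening`).

Spanning: `n⁺` acts on `gr V(λ)` compatibly with its action on `S(n⁻)` and kills the class of `v_λ`.
The annihilator of this class is therefore stable under `U(n⁺)`, and contains `I(λ)` once it
contains the powers generating `R` (`IsSingular.grAct_idealI`). Induction along the monomial order
then reduces every monomial to `S(λ)`.

The powers kill `v_λ` by an explicit model: in the polynomials on `2n × n` matrices, the product of
leading minors `∏ Δ_k^{m_k}` is a singular vector of weight `λ`. A root vector acts on each minor
with square zero, and by zero on all but the minors counted by the exponent
(`matDer_iterate_of_mem_rootPowers`). Relations pass from any nonzero singular vector to the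
irreducible module by looking at the submodule generated by the pair of the two vectors in the
direct sum (`IsIrreducibleHighestWeight.actList_eq_zero`). -/

noncomputable section

namespace SymplecticPBW

/-! ### The model of `sp_{2n}` as a symmetric square -/

section Model

variable {n : ℕ}

/-- The sign of a basis vector, `1` for the first block and `-1` for the second one. -/
def sgn : Fin n ⊕ Fin n → ℂ
  | Sum.inl _ => 1
  | Sum.inr _ => -1

theorem sgn_swap (a : Fin n ⊕ Fin n) : sgn a.swap = - sgn a := by
  cases a <;> simp [sgn]

theorem sgn_mul_self (a : Fin n ⊕ Fin n) : sgn a * sgn a = 1 := by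
  cases a <;> simp [sgn]

theorem pos_swap (a : Fin n ⊕ Fin n) : pos a.swap = - pos a := by
  cases a <;> simp [pos]

theorem pos_injective : Function.Injective (pos (n := n)) := by
  rintro (a | a) (b | b) h <;> simp only [pos] at h
  · congr 1; ext; omega
  · have := a.2; have := b.2; omega
  · have := a.2; have := b.2; omega
  · congr 1; ext; omega

theorem swap_eq_iff (x y : Fin n ⊕ Fin n) : x.swap = y ↔ x = y.swap :=
  ⟨fun h => by rw [← h, Sum.swap_swap], fun h => by rw [h, Sum.swap_swap]⟩

/-- The entry of a matrix at a given place, as a linear functional. -/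
def entry (p q : Fin n ⊕ Fin n) : Sp n →ₗ[ℂ] ℂ where
  toFun X := X.1 p q
  map_add' _ _ := rfl
  map_smul' _ _ := rfl

/-- The three block conditions together say that the form `sgn a* · Y_{a*, b}` is symmetric in `a`
and `b`. This is the identification with the symmetric square. -/
theorem mem_sp_iff_swap (Y : Matrix (Fin n ⊕ Fin n) (Fin n ⊕ Fin n) ℂ) :
    Y ∈ LieAlgebra.Symplectic.sp (Fin n) ℂ ↔
      ∀ a b, sgn b.swap * Y b.swap a = - (sgn a * Y a.swap b) := by
  rw [mem_sp_iff]
  constructor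
  · rintro ⟨h1, h2, h3⟩ (i | i) (j | j)
    · simp [sgn, h3 i j]
    · simp [sgn, h1 i j]
    · simp [sgn, h1 j i]
    · simp [sgn, h2 i j]
  · intro h
    refine ⟨fun i j => ?_, fun i j => ?_, fun i j => ?_⟩
    · exact neg_injective (by simpa [sgn] using h (Sum.inr j) (Sum.inl i))
    · simpa [sgn] using (h (Sum.inr i) (Sum.inr j)).symm
    · simpa [sgn] using (h (Sum.inl i) (Sum.inl j)).symm

/-- The element `x_a x_b` of `S²(ℂ^{2n}) ≅ sp_{2n}`. -/
def symProd (a b : Fin n ⊕ Fin n) : Sp n :=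
  ⟨Matrix.of fun p q => (if p = a then if q = b.swap then sgn b else 0 else 0) +
    (if p = b then if q = a.swap then sgn a else 0 else 0), by
    rw [mem_sp_iff_swap]
    intro p q
    have hp : ∀ y : Fin n ⊕ Fin n, p.swap = y ↔ p = y.swap := fun y => swap_eq_iff p y
    have hq : ∀ y : Fin n ⊕ Fin n, q.swap = y ↔ q = y.swap := fun y => swap_eq_iff q y
    simp only [Matrix.of_apply, hp, hq]
    by_cases h1 : p = a.swap <;> by_cases h2 : p = b.swap <;> by_cases h3 : q = a.swap <;>
      by_cases h4 : q = b.swap <;> simp only [h1, h2, h3, h4, if_true, if_false] <;>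
      simp_all [sgn_swap, mul_comm]⟩

theorem symProd_apply (a b p q : Fin n ⊕ Fin n) : (symProd a b).1 p q =
    (if p = a then if q = b.swap then sgn b else 0 else 0) +
    (if p = b then if q = a.swap then sgn a else 0 else 0) := rfl

theorem symProd_comm (a b : Fin n ⊕ Fin n) : symProd a b = symProd b a := by
  ext p q
  rw [symProd_apply, symProd_apply, add_comm]

/-! ### The adjoint action on products of basis vectors. -/

theorem lie_apply (X Y : Sp n) (p q : Fin n ⊕ Fin n) :
    (⁅X, Y⁆ : Sp n).1 p q = ∑ c, X.1 p c * Y.1 c q - ∑ c, Y.1 p c * X.1 c q := by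
  change (X.1 * Y.1 - Y.1 * X.1) p q = _
  rw [Matrix.sub_apply, Matrix.mul_apply, Matrix.mul_apply]

/-- The adjoint representation is the symmetric square of the natural one. The terms of the
commutator with `Y` on the right take the required shape through the skew-adjointness `key`. -/
theorem lie_symProd (Y : Sp n) (a b : Fin n ⊕ Fin n) :
    ⁅Y, symProd a b⁆ = ∑ c, Y.1 c a • symProd c b + ∑ c, Y.1 c b • symProd a c := by
  ext p q
  have key : ∀ x y : Fin n ⊕ Fin n, sgn y.swap * Y.1 y.swap x = - (sgn x * Y.1 x.swap y) :=
    (mem_sp_iff_swap _).1 Y.2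
  have hq : ∀ y : Fin n ⊕ Fin n, q = y.swap ↔ y = q.swap := fun y =>
    ⟨fun h => by rw [h, Sum.swap_swap], fun h => by rw [h, Sum.swap_swap]⟩
  change _ = entry p q (∑ c, Y.1 c a • symProd c b + ∑ c, Y.1 c b • symProd a c)
  simp only [map_add, map_sum, map_smul, smul_eq_mul]
  change _ = ∑ c, Y.1 c a * (symProd c b).1 p q + ∑ c, Y.1 c b * (symProd a c).1 p q
  have ka := key a q
  have kb := key b q
  rw [lie_apply]
  simp only [symProd_apply, mul_add, add_mul, Finset.sum_add_distrib, ite_mul, mul_ite, zero_mul,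
    mul_zero, hq]
  have hc : ∀ (P : Prop) [Decidable P] (F : Fin n ⊕ Fin n → ℂ),
      (∑ c, if P then F c else 0) = if P then ∑ c, F c else 0 := fun P _ F => by
    split_ifs <;> simp
  simp only [hc, Finset.sum_ite_eq', Finset.sum_ite_eq, Finset.mem_univ, if_true]
  split_ifs <;> first
    | ring1 | linear_combination -ka | linear_combination -kb
    | linear_combination -ka - kb

/-- The image of `x_a x_b` in `n⁻ ≅ sp_{2n} / (h ⊕ n⁺)`. -/
def negProd (a b : Fin n ⊕ Fin n) : nMinus n := projMinus n (symProd a b)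

theorem negProd_comm (a b : Fin n ⊕ Fin n) : negProd a b = negProd b a := by
  rw [negProd, symProd_comm, negProd]

theorem negProd_apply (a b p q : Fin n ⊕ Fin n) : (negProd a b).1.1 p q =
    if pos q < pos p then (symProd a b).1 p q else 0 := rfl

/-- The entries of `x_a x_b` sit at the places `(a, b*)` and `(b, a*)`; since `pos b* = - pos b`,
both are strictly below the diagonal or neither is, according to the sign of `pos a + pos b`. -/
theorem negProd_eq_zero {a b : Fin n ⊕ Fin n} (h : pos a + pos b ≤ 0) : negProd a b = 0 := by
  ext p q
  rw [negProd_apply, symProd_apply]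
  change _ = (0 : ℂ)
  split_ifs with h1 h2 h3 h4 h5 h6 h7 <;> first | simp; done | skip
  all_goals
    exfalso
    subst_vars
    simp only [pos_swap] at *
    omega

theorem coe_negProd {a b : Fin n ⊕ Fin n} (h : 0 < pos a + pos b) :
    (negProd a b : Sp n) = symProd a b := by
  ext p q
  rw [negProd_apply, symProd_apply]
  split_ifs with h1 h2 h3 h4 h5 h6 h7 <;> first | simp; done | skip
  all_goals
    exfalso
    subst_vars
    simp only [pos_swap] at *
    omega

theorem actMinus_negProd (e : nPlus n) (a b : Fin n ⊕ Fin n) :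
    actMinus n e (negProd a b) =
      ∑ c, e.1.1 c a • negProd c b + ∑ c, e.1.1 c b • negProd a c := by
  change projMinus n ⁅(e : Sp n), (projMinus n (symProd a b) : Sp n)⁆ = _
  rw [projMinus_lie, lie_symProd, map_add, map_sum, map_sum]
  simp only [map_smul, negProd]

/-- The element of `n⁺` which maps `x_v` to `x_k`, and `x_{k*}` to a multiple of `x_{v*}`. -/
def lower (v k : Fin n ⊕ Fin n) (h : pos k < pos v) : nPlus n :=
  ⟨sgn v.swap • symProd k v.swap, fun a b hab => by
    change sgn v.swap * (symProd k v.swap).1 a b = 0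
    rw [symProd_apply]
    split_ifs with h1 h2 h3 h4 h5 h6 h7 <;> first | simp; done | skip
    all_goals
      exfalso
      subst_vars
      simp only [pos_swap] at *
      omega⟩

theorem lower_apply {v k : Fin n ⊕ Fin n} (h : pos k < pos v) (c a : Fin n ⊕ Fin n) :
    (lower v k h).1.1 c a = (if c = k then if a = v then 1 else 0 else 0) +
      (if c = v.swap then if a = k.swap then sgn v.swap * sgn k else 0 else 0) := by
  change sgn v.swap * (symProd k v.swap).1 c a = _
  rw [symProd_apply, Sum.swap_swap, mul_add, mul_ite, mul_ite, mul_ite, mul_ite, sgn_mul_self]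
  simp only [mul_zero]

theorem actMinus_lower {v k : Fin n ⊕ Fin n} (h : pos k < pos v) (a b : Fin n ⊕ Fin n) :
    actMinus n (lower v k h) (negProd a b) =
      ((if a = v then negProd k b else 0) +
        (if a = k.swap then (sgn v.swap * sgn k) • negProd v.swap b else 0)) +
      ((if b = v then negProd a k else 0) +
        (if b = k.swap then (sgn v.swap * sgn k) • negProd a v.swap else 0)) := by
  rw [actMinus_negProd]
  simp only [lower_apply, add_smul, ite_smul, zero_smul, one_smul, Finset.sum_add_distrib,
    Finset.sum_ite_eq', Finset.mem_univ, if_true]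

/-- The source of positivity: the signed terms contain `x_{v*}` times a vector not later than `v`,
and such a product is zero in `n⁻`. -/
theorem actMinus_lower_of_le {v k : Fin n ⊕ Fin n} (h : pos k < pos v) {a b : Fin n ⊕ Fin n}
    (ha : pos a ≤ pos v) (hb : pos b ≤ pos v) :
    actMinus n (lower v k h) (negProd a b) =
      (if a = v then negProd k b else 0) + (if b = v then negProd a k else 0) := by
  rw [actMinus_lower, negProd_eq_zero (a := v.swap) (b := b) (by rw [pos_swap]; omega),
    negProd_eq_zero (a := a) (b := v.swap) (by rw [pos_swap]; omega)]
  simp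

/-! ### The root vectors in the model -/

/-- The first of the two basis vectors whose product is a root vector of weight `-α`. -/
def PosRoot.fst (α : PosRoot n) : Fin n ⊕ Fin n :=
  if h : (α.1.2 : ℕ) + 1 < n then Sum.inl ⟨α.1.2 + 1, h⟩
  else Sum.inr ⟨2 * n - 2 - α.1.2, by have := α.1.2.2; omega⟩

/-- The second of the two basis vectors whose product is a root vector of weight `-α`. -/
def PosRoot.snd (α : PosRoot n) : Fin n ⊕ Fin n := Sum.inr α.1.1

/-- No basis vector has position `0`, hence the jump by two between the letters `n - 1` and `n`. -/
theorem PosRoot.pos_fst (α : PosRoot n) : pos α.fst =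
    if (α.1.2 : ℕ) + 1 < n then (α.1.2 : ℤ) + 1 - n else (α.1.2 : ℤ) + 2 - n := by
  have := α.1.2.2
  unfold PosRoot.fst
  split_ifs with h
  · simp [pos]
  · simp only [pos]; omega

theorem PosRoot.pos_snd (α : PosRoot n) : pos α.snd = n - (α.1.1 : ℤ) := rfl

theorem PosRoot.pos_fst_le (α : PosRoot n) : pos α.fst ≤ pos α.snd := by
  rw [α.pos_fst, α.pos_snd]
  have := α.2.1; have := α.2.2; have := α.1.1.2; have := α.1.2.2
  split_ifs <;> omega

theorem PosRoot.pos_add_pos (α : PosRoot n) : 0 < pos α.fst + pos α.snd := by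
  rw [α.pos_fst, α.pos_snd]
  have := α.2.1; have := α.2.2; have := α.1.1.2; have := α.1.2.2
  split_ifs <;> omega

theorem PosRoot.ext_fst_snd {α β : PosRoot n} (h1 : α.fst = β.fst) (h2 : α.snd = β.snd) :
    α = β := by
  have e1 := congrArg pos h1
  have e2 := congrArg pos h2
  rw [α.pos_fst, β.pos_fst] at e1
  rw [α.pos_snd, β.pos_snd] at e2
  refine Subtype.ext (Prod.ext (Fin.ext ?_) (Fin.ext ?_))
  · omega
  · split_ifs at e1 <;> omega

theorem PosRoot.exists_fst_snd {a b : Fin n ⊕ Fin n} (h : 0 < pos a + pos b)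
    (hab : pos a ≤ pos b) : ∃ α : PosRoot n, α.fst = a ∧ α.snd = b := by
  obtain (i | i) := b
  · exfalso
    simp only [pos] at h hab
    have := i.2
    omega
  obtain (k | k) := a
  · simp only [pos] at h hab
    have := k.2; have := i.2
    have h1 : (k : ℕ) - 1 + 1 = k := by omega
    refine ⟨⟨(i, ⟨k - 1, by omega⟩), by simp only; omega, by simp only; omega⟩, ?_, rfl⟩
    apply pos_injective
    rw [PosRoot.pos_fst]
    simp only [pos]
    split_ifs <;> omega
  · simp only [pos] at h hab
    have := k.2; have := i.2
    refine ⟨⟨(i, ⟨2 * n - 2 - k, by omega⟩), by simp only; omega, by simp only; omega⟩, ?_, rfl⟩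
    apply pos_injective
    rw [PosRoot.pos_fst]
    simp only [pos]
    split_ifs <;> omega

end Model

/-! ### Polynomials with natural coefficients -/

section NatPolynomials

open MvPolynomial

variable {σ : Type*}

/-- `q - p` has nonnegative coefficients. -/
def Dominated {A : Type*} [CommSemiring A] (p q : A) : Prop := ∃ r, q = p + r

theorem Dominated.refl {A : Type*} [CommSemiring A] (p : A) : Dominated p p := ⟨0, by simp⟩

theorem Dominated.trans {A : Type*} [CommSemiring A] {p q r : A} (h : Dominated p q)
    (h' : Dominated q r) : Dominated p r := by
  obtain ⟨a, rfl⟩ := h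
  obtain ⟨b, rfl⟩ := h'
  exact ⟨a + b, add_assoc _ _ _⟩

theorem Dominated.mul_left {A : Type*} [CommSemiring A] {p q : A} (a : A) (h : Dominated p q) :
    Dominated (a * p) (a * q) := by
  obtain ⟨r, rfl⟩ := h
  exact ⟨a * r, mul_add _ _ _⟩

theorem Dominated.map {R A : Type*} [CommSemiring R] [CommSemiring A] [Algebra R A]
    {p q : A} (D : Derivation R A A) (h : Dominated p q) : Dominated (D p) (D q) := by
  obtain ⟨r, rfl⟩ := h
  exact ⟨D r, map_add _ _ _⟩

theorem Dominated.sum {A ι : Type*} [CommSemiring A] {s : Finset ι} {i : ι}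
    (h : i ∈ s) (F : ι → A) : Dominated (F i) (∑ j ∈ s, F j) := by
  classical
  exact ⟨∑ j ∈ s.erase i, F j, (Finset.add_sum_erase s F h).symm⟩

/-- A derivation which shifts the weights of the variables by `δ` shifts all weights by `δ`. -/
theorem isWeightedHomogeneous_mkDerivation {M R : Type*} [CommSemiring R] [AddCommMonoid M]
    {w : σ → M} {δ : M} {g : σ → MvPolynomial σ R}
    (hg : ∀ i, IsWeightedHomogeneous w (g i) (w i + δ)) {p : MvPolynomial σ R} {c : M}
    (hp : IsWeightedHomogeneous w p c) :
    IsWeightedHomogeneous w (mkDerivation R g p) (c + δ) := by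
  rw [p.as_sum, map_sum]
  refine IsWeightedHomogeneous.sum _ _ _ fun s hs => ?_
  rw [mkDerivation_monomial, MvPolynomial.smul_eq_C_mul]
  refine IsWeightedHomogeneous.C_mul (IsWeightedHomogeneous.sum _ _ _ fun i hi => ?_) _
  have hc := hp (mem_support_iff.1 hs)
  have h1 : Finsupp.weight w (s - Finsupp.single i 1) + w i = c := by
    rw [← hc]
    conv_rhs => rw [← tsub_add_cancel_of_le (show Finsupp.single i 1 ≤ s by
      simpa [Nat.one_le_iff_ne_zero] using hi), map_add, Finsupp.weight_single, one_smul]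
  rw [← h1, add_assoc]
  exact (isWeightedHomogeneous_monomial _ _ _ rfl).mul (hg i)

/-- A composition of derivations. -/
def word {R ι A : Type*} [CommSemiring R] [CommSemiring A] [Algebra R A]
    (D : ι → Derivation R A A) (l : List ι) (p : A) : A :=
  l.foldr (fun k q => D k q) p

theorem word_append {R ι A : Type*} [CommSemiring R] [CommSemiring A] [Algebra R A]
    (D : ι → Derivation R A A) (l l' : List ι)
    (p : A) : word D (l ++ l') p = word D l (word D l' p) := by
  simp [word]

theorem Dominated.word {R ι A : Type*} [CommSemiring R] [CommSemiring A] [Algebra R A]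
    (D : ι → Derivation R A A) (l : List ι)
    {p q : A} (h : Dominated p q) : Dominated (word D l p) (word D l q) := by
  induction l with
  | nil => exact h
  | cons k l ih => exact ih.map (D k)

theorem dominated_word_mul {R ι A : Type*} [CommSemiring R] [CommSemiring A] [Algebra R A]
    (D : ι → Derivation R A A)
    (l : List ι) (a b : A) :
    Dominated (a * SymplecticPBW.word D l b) (SymplecticPBW.word D l (a * b)) := by
  induction l with
  | nil => exact Dominated.refl _
  | cons k l ih =>
    refine Dominated.trans ?_ (ih.map (D k))
    rw [Derivation.leibniz]
    exact ⟨_, rfl⟩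

/-- If every letter can be reached from its starting letter by a word, then every product of
letters can be reached from the product of the starting letters. -/
theorem exists_word_prod {R ι τ A : Type*} [CommSemiring R] [CommSemiring A] [Algebra R A]
    (D : ι → Derivation R A A)
    (K : Set ι) (x st : τ → A) (S : Multiset τ)
    (h : ∀ a ∈ S, ∃ l : List ι, (∀ k ∈ l, k ∈ K) ∧ Dominated (x a) (word D l (st a))) :
    ∃ l : List ι, (∀ k ∈ l, k ∈ K) ∧ Dominated (S.map x).prod (word D l (S.map st).prod) := by
  induction S using Multiset.induction with
  | empty => exact ⟨[], by simp, by simpa [word] using Dominated.refl _⟩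
  | cons a S ih =>
    obtain ⟨l, hl, hd⟩ := ih fun b hb => h b (Multiset.mem_cons_of_mem hb)
    obtain ⟨l', hl', hd'⟩ := h a (Multiset.mem_cons_self a S)
    refine ⟨l' ++ l, fun k hk => (List.mem_append.1 hk).elim (hl' k) (hl k), ?_⟩
    rw [word_append, Multiset.map_cons, Multiset.map_cons, Multiset.prod_cons,
      Multiset.prod_cons]
    refine Dominated.trans ?_ ((dominated_word_mul D l (st a) (S.map st).prod).word D l')
    refine Dominated.trans ?_ ((hd.mul_left (st a)).word D l')
    rw [mul_comm (st a)]
    refine Dominated.trans ?_ (dominated_word_mul D l' _ (st a))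
    rw [mul_comm]
    exact hd'.mul_left _

end NatPolynomials

/-! ### The monomial order -/

section Order

variable {n : ℕ}

/-- The key `(q, i)` of the root `α_{i,q}`, in the lexicographic order. -/
def PosRoot.key (α : PosRoot n) : J n ×ₗ Fin n := toLex (α.1.2, α.1.1)

theorem PosRoot.key_injective : Function.Injective (PosRoot.key (n := n)) := by
  intro α β h
  have h' : (α.1.2, α.1.1) = (β.1.2, β.1.1) := h
  rw [Prod.mk.injEq] at h'
  exact Subtype.ext (Prod.ext h'.2 h'.1)

/-- The linear order on the positive roots by the second index, then by the first one. -/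
@[reducible]
def rootOrder (n : ℕ) : LinearOrder (PosRoot n) :=
  LinearOrder.lift' PosRoot.key PosRoot.key_injective

/-- The lexicographic order of the multi-exponents, the first root being the most significant. -/
def rootLex (n : ℕ) : MonomialOrder.{0, 0} (PosRoot n) :=
  letI := rootOrder n
  haveI : @WellFoundedGT (PosRoot n) (rootOrder n).toLT :=
    @Finite.to_wellFoundedGT _ _ (rootOrder n).toPreorder
  @MonomialOrder.lex (PosRoot n) (rootOrder n) this

theorem PosRoot.key_lt_iff (α β : PosRoot n) : α.key < β.key ↔
    (α.1.2 : ℕ) < β.1.2 ∨ ((α.1.2 : ℕ) = β.1.2 ∧ (α.1.1 : ℕ) < β.1.1) := by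
  rw [PosRoot.key, PosRoot.key, Prod.Lex.toLex_lt_toLex, Fin.lt_def, Fin.lt_def, Fin.ext_iff]

theorem rootLex_lt {s t : PosRoot n →₀ ℕ} (α : PosRoot n)
    (h : ∀ β : PosRoot n, β.key < α.key → t β = s β) (hα : t α < s α) :
    (rootLex n).toSyn t < (rootLex n).toSyn s := by
  exact (Finsupp.lex_def (r := (rootOrder n).lt)).2 ⟨α, h, hα⟩

/-- The content of a root: the multiset of the two basis vectors. -/
def PosRoot.content (α : PosRoot n) : (Fin n ⊕ Fin n) → ℤ :=
  Pi.single α.fst 1 + Pi.single α.snd 1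

theorem PosRoot.content_nonneg (α : PosRoot n) (b : Fin n ⊕ Fin n) : 0 ≤ α.content b := by
  simp only [PosRoot.content, Pi.add_apply, Pi.single_apply]
  split_ifs <;> norm_num

theorem PosRoot.content_eq_zero {α : PosRoot n} {b : Fin n ⊕ Fin n} (h1 : b ≠ α.fst)
    (h2 : b ≠ α.snd) : α.content b = 0 := by
  simp [PosRoot.content, h1, h2]

theorem PosRoot.content_fst_pos (α : PosRoot n) : 0 < α.content α.fst := by
  simp only [PosRoot.content, Pi.add_apply, Pi.single_apply]
  split_ifs <;> norm_num at *

theorem PosRoot.content_snd_pos (α : PosRoot n) : 0 < α.content α.snd := by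
  simp only [PosRoot.content, Pi.add_apply, Pi.single_apply]
  split_ifs <;> norm_num at *

theorem weight_content_apply (s : PosRoot n →₀ ℕ) (b : Fin n ⊕ Fin n) :
    Finsupp.weight PosRoot.content s b = ∑ α, (s α : ℤ) * α.content b := by
  rw [Finsupp.weight_apply, Finsupp.sum_fintype _ _ (by simp), Finset.sum_apply]
  simp

/-- Each root vector is a product of two basis vectors, so the total content is twice the degree. -/
theorem degree_eq_of_weight_content {s t : PosRoot n →₀ ℕ}
    (h : Finsupp.weight PosRoot.content t = Finsupp.weight PosRoot.content s) :
    t.degree = s.degree := by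
  have key : ∀ s : PosRoot n →₀ ℕ,
      ∑ b, Finsupp.weight PosRoot.content s b = 2 * (s.degree : ℤ) := fun s => by
    simp only [weight_content_apply]
    rw [Finset.sum_comm, Finsupp.degree_eq_sum, Nat.cast_sum, Finset.mul_sum]
    refine Finset.sum_congr rfl fun α _ => ?_
    rw [← Finset.mul_sum]
    simp only [PosRoot.content, Pi.add_apply, Finset.sum_add_distrib, Finset.sum_pi_single',
      Finset.mem_univ, if_true]
    ring
  have h1 := key t
  rw [h, key s] at h1
  omega

/-- A multi-exponent supported on a chain is maximal among those with the same content. -/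
theorem rootLex_lt_of_chain {s t : PosRoot n →₀ ℕ}
    (hs : ∀ α β, s α ≠ 0 → s β ≠ 0 → (α.1.1 : ℕ) < β.1.1 → (α.1.2 : ℕ) ≤ β.1.2)
    (h : Finsupp.weight PosRoot.content t = Finsupp.weight PosRoot.content s) (hne : t ≠ s) :
    (rootLex n).toSyn t < (rootLex n).toSyn s := by
  classical
  obtain ⟨α, hα, hmin⟩ : ∃ α, t α ≠ s α ∧ ∀ β : PosRoot n, β.key < α.key → t β = s β := by
    have hne' : (Finset.univ.filter fun α => t α ≠ s α).Nonempty := by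
      by_contra hc
      rw [Finset.not_nonempty_iff_eq_empty, Finset.filter_eq_empty_iff] at hc
      exact hne (Finsupp.ext fun α => not_not.1 (hc (Finset.mem_univ α)))
    obtain ⟨α, hα, hm⟩ := Finset.exists_min_image _ PosRoot.key hne'
    refine ⟨α, (Finset.mem_filter.1 hα).2, fun β hβ => ?_⟩
    by_contra hc
    exact absurd (hm β (Finset.mem_filter.2 ⟨Finset.mem_univ _, hc⟩)) (not_le.2 hβ)
  refine rootLex_lt α hmin (lt_of_le_of_ne (not_lt.1 fun hlt => ?_) hα)
  -- Let `α = (i, q)`. A later root of `s` that contains `α.fst` has second index `q` and first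
  -- index above `i`; a later root of `s` that contains `α.snd` has first index at most `i` and
  -- second index above `q`. Two such roots cannot lie on a chain, so one of the two vectors of `α`
  -- occurs in no later root of `s`.
  have hb : ∃ b, 0 < α.content b ∧ ∀ β : PosRoot n, α.key < β.key → s β ≠ 0 →
      β.content b = 0 := by
    by_contra hc
    push Not at hc
    obtain ⟨β, hβ, hsβ, hβc⟩ := hc α.fst α.content_fst_pos
    obtain ⟨γ, hγ, hsγ, hγc⟩ := hc α.snd α.content_snd_pos
    have hβ' : pos α.fst = pos β.fst ∨ pos α.fst = pos β.snd := by
      by_contra hcon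
      push Not at hcon
      exact hβc (PosRoot.content_eq_zero (fun e => hcon.1 (by rw [e])) fun e => hcon.2 (by rw [e]))
    have hγ' : pos α.snd = pos γ.fst ∨ pos α.snd = pos γ.snd := by
      by_contra hcon
      push Not at hcon
      exact hγc (PosRoot.content_eq_zero (fun e => hcon.1 (by rw [e])) fun e => hcon.2 (by rw [e]))
    rw [PosRoot.key_lt_iff] at hβ hγ
    have c1 := hs β γ hsβ hsγ
    have c2 := hs γ β hsγ hsβ
    have a1 := α.pos_fst_le
    have b1 := β.pos_fst_le
    have g1 := γ.pos_fst_le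
    have := α.1.1.2; have := β.1.1.2; have := γ.1.1.2
    simp only [PosRoot.pos_fst, PosRoot.pos_snd] at *
    split_ifs at * <;> omega
  obtain ⟨b, hb0, hb⟩ := hb
  have hsum : ∑ β, ((t β : ℤ) - s β) * β.content b = 0 := by
    simp only [sub_mul, Finset.sum_sub_distrib]
    rw [← weight_content_apply, ← weight_content_apply, h, sub_self]
  -- Count the vector `b`: roots before `α` contribute zero to the difference, `α` contributes a
  -- positive amount, and later ones cannot compensate because `s` has no `b` left there.
  refine absurd hsum (ne_of_gt (Finset.sum_pos' (fun β _ => ?_) ⟨α, Finset.mem_univ _, ?_⟩))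
  · rcases lt_trichotomy β.key α.key with hlt' | heq | hgt
    · rw [hmin β hlt']; simp
    · rw [PosRoot.key_injective heq]
      exact mul_nonneg (by omega) hb0.le
    · by_cases h0 : s β = 0
      · rw [h0]
        exact mul_nonneg (by simp) (PosRoot.content_nonneg _ _)
      · rw [hb β hgt h0, mul_zero]
  · exact mul_pos (by omega) hb0

end Order

/-! ### Root vectors are multiples of the model ones -/

section RootVectors

variable {n : ℕ}

/-- The weight of the basis vector at the position `p`, evaluated at a matrix. -/
def diagAt (H : Sp n) (p : ℕ) : ℂ :=
  if h : p < n then H.1 (Sum.inl ⟨p, h⟩) (Sum.inl ⟨p, h⟩)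
  else if h' : p < 2 * n then
    H.1 (Sum.inr ⟨2 * n - 1 - p, by omega⟩) (Sum.inr ⟨2 * n - 1 - p, by omega⟩)
  else 0

theorem sp_diag (H : Sp n) (k : Fin n) :
    H.1 (Sum.inr k) (Sum.inr k) = - H.1 (Sum.inl k) (Sum.inl k) :=
  ((mem_sp_iff H.1).1 H.2).1 k k

/-- Along `1 < ... < n < n' < ... < 1'` consecutive weights differ by a simple root, read off
through `absJ`. This makes the sum defining a positive root telescope. -/
theorem simpleRoot_absJ (H : Sp n) (k : J n) :
    simpleRoot (absJ k) H = diagAt H k - diagAt H (k + 1) := by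
  have hk := k.2
  by_cases h1 : (k : ℕ) + 1 < n
  · have e : absJ k = ⟨k, by omega⟩ := dif_pos _
    rw [e, simpleRoot, dif_pos h1, diagAt, diagAt, dif_pos (by omega), dif_pos h1]
    rfl
  by_cases h2 : (k : ℕ) < n
  · have e : absJ k = ⟨k, h2⟩ := dif_pos _
    rw [e, simpleRoot, dif_neg h1, diagAt, diagAt, dif_pos h2, dif_neg h1, dif_pos (by omega),
      sp_diag]
    have e : (⟨2 * n - 1 - (k + 1), by omega⟩ : Fin n) = ⟨k, h2⟩ := Fin.ext (by simp only; omega)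
    rw [e]
    change (2 : ℂ) * H.1 (Sum.inl ⟨k, h2⟩) (Sum.inl ⟨k, h2⟩) = _
    ring
  · have e : absJ k = ⟨2 * n - 2 - k, by omega⟩ := dif_neg h2
    have h3 : 2 * n - 2 - k + 1 < n := by omega
    rw [e, simpleRoot, dif_pos h3, diagAt, diagAt, dif_neg h2, dif_neg h1, dif_pos (by omega),
      dif_pos (by omega), sp_diag, sp_diag]
    have e : (⟨2 * n - 1 - (k + 1), by omega⟩ : Fin n) = ⟨2 * n - 2 - k, by omega⟩ :=
      Fin.ext (by simp only; omega)
    have e' : (⟨2 * n - 2 - k + 1, h3⟩ : Fin n) = ⟨2 * n - 1 - k, by omega⟩ :=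
      Fin.ext (by simp only; omega)
    rw [e, e']
    change H.1 _ _ - H.1 _ _ = _
    ring

theorem root_apply (α : PosRoot n) (H : Sp n) :
    α.root H = -(H.1 α.fst α.fst + H.1 α.snd α.snd) := by
  have h1 : α.root H = ∑ k ∈ Finset.Ico (α.1.1 : ℕ) (α.1.2 + 1),
      (diagAt H k - diagAt H (k + 1)) := by
    rw [PosRoot.root, LinearMap.sum_apply]
    refine Finset.sum_nbij (fun k => (k : ℕ)) ?_ ?_ ?_ ?_
    · intro k hk
      simp only [Finset.mem_filter, Finset.mem_univ, true_and, Fin.le_def] at hk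
      simp only [Finset.mem_Ico]
      omega
    · intro k _ l _ h
      exact Fin.ext h
    · intro k hk
      simp only [Finset.coe_Ico, Set.mem_Ico] at hk
      have := α.1.2.2
      refine ⟨⟨k, by omega⟩, ?_, rfl⟩
      simp only [Finset.coe_filter, Finset.mem_univ, true_and, Set.mem_ofPred_eq, Fin.le_def]
      omega
    · intro k _
      exact simpleRoot_absJ H k
  have h2 : ∀ a b : ℕ, a ≤ b → ∑ k ∈ Finset.Ico a b, (diagAt H k - diagAt H (k + 1)) =
      diagAt H a - diagAt H b := fun a b hab => by
    induction b, hab using Nat.le_induction with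
    | base => simp
    | succ b hb ih => rw [Finset.sum_Ico_succ_top hb, ih]; ring
  have hq := α.1.2.2
  have hi := α.1.1.2
  rw [h1, h2 _ _ (by have := α.2.1; omega)]
  have e1 : diagAt H α.1.1 = - H.1 α.snd α.snd := by
    rw [diagAt, dif_pos hi, PosRoot.snd, sp_diag, neg_neg]
  have e2 : diagAt H (α.1.2 + 1) = H.1 α.fst α.fst := by
    unfold diagAt PosRoot.fst
    split_ifs
    · rfl
    · have e : (⟨2 * n - 1 - (α.1.2 + 1), by omega⟩ : Fin n) = ⟨2 * n - 2 - α.1.2, by omega⟩ :=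
        Fin.ext (by simp only; omega)
      rw [e]
    · omega
  rw [e1, e2]
  ring

theorem symProd_mem_cartan (k : Fin n) : symProd (Sum.inl k) (Sum.inr k) ∈ cartan n := by
  intro a b h
  rw [symProd_apply]
  simp only [Sum.swap_inl, Sum.swap_inr]
  split_ifs <;> simp_all

theorem symProd_diag (k : Fin n) (a : Fin n ⊕ Fin n) :
    (symProd (Sum.inl k) (Sum.inr k)).1 a a =
      (((if a = Sum.inr k then 1 else 0) - (if a = Sum.inl k then 1 else 0) : ℤ) : ℂ) := by
  rw [symProd_apply]
  simp only [Sum.swap_inl, Sum.swap_inr, sgn]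
  split_ifs <;> simp_all

/-- The indicator differences are the coordinates of a weight in the basis `-ε_k`. The hypothesis on
`u` excludes the weight zero, which all products `x_k x_{k*}` share. -/
theorem pair_eq_of_weight {a b u : Fin n ⊕ Fin n} {i : Fin n} (hu : u ≠ Sum.inl i)
    (h : ∀ k : Fin n, ((if a = Sum.inr k then 1 else 0) - (if a = Sum.inl k then 1 else 0) +
      ((if b = Sum.inr k then 1 else 0) - (if b = Sum.inl k then 1 else 0)) : ℤ) =
      (if u = Sum.inr k then 1 else 0) - (if u = Sum.inl k then 1 else 0) +
      ((if (Sum.inr i : Fin n ⊕ Fin n) = Sum.inr k then 1 else 0) -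
        (if (Sum.inr i : Fin n ⊕ Fin n) = Sum.inl k then 1 else 0))) :
    (a = u ∧ b = Sum.inr i) ∨ (a = Sum.inr i ∧ b = u) := by
  have aux : ∀ x y : Fin n ⊕ Fin n, (∀ k : Fin n,
      ((if x = Sum.inr k then 1 else 0) - (if x = Sum.inl k then 1 else 0) : ℤ) =
      (if y = Sum.inr k then 1 else 0) - (if y = Sum.inl k then 1 else 0)) → x = y := by
    rintro (x | x) y hxy <;>
    · have := hxy x
      simp only [reduceCtorEq, if_true, if_false] at this
      split_ifs at this <;> simp_all
  have hi : a = Sum.inr i ∨ b = Sum.inr i := by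
    by_contra hc
    push Not at hc
    have := h i
    rw [if_neg hc.1, if_neg hc.2, if_neg hu] at this
    simp only [reduceCtorEq, if_true, if_false] at this
    split_ifs at this <;> omega
  rcases hi with rfl | rfl
  · refine Or.inr ⟨rfl, aux _ _ fun k => ?_⟩
    have := h k
    linarith
  · refine Or.inl ⟨aux _ _ fun k => ?_, rfl⟩
    have := h k
    linarith

/-- A diagonal `H` scales the entry at `(p, q)` by `H_p - H_q`, the weight of `x_p x_{q*}`. A
nonzero entry forces this weight to be `-α`, which determines the unordered pair. The matrices `x_k
x_{k*}` suffice as test elements. -/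
theorem rootVector_entry {f : PosRoot n → nMinus n} (hf : IsRootVectors f) (α : PosRoot n)
    {p q : Fin n ⊕ Fin n} (h : (f α).1.1 p q ≠ 0) :
    (p = α.fst ∧ q = α.snd.swap) ∨ (p = α.snd ∧ q = α.fst.swap) := by
  have hpair := pair_eq_of_weight (a := p) (b := q.swap) (u := α.fst) (i := α.1.1)
    (fun e => by
      have := α.pos_add_pos
      rw [e, PosRoot.snd] at this
      simp [pos] at this) (fun k => by
      have hH := hf.lie_eq α _ (symProd_mem_cartan k)
      have he := congrArg (fun X : Sp n => X.1 p q) hH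
      simp only [lie_apply] at he
      rw [root_apply, neg_neg] at he
      change _ = _ * (f α).1.1 p q at he
      rw [Finset.sum_eq_single p (fun c _ hc => by
          rw [symProd_mem_cartan k p c hc.symm, zero_mul]) (by simp),
        Finset.sum_eq_single q (fun c _ hc => by
          rw [symProd_mem_cartan k c q hc, mul_zero]) (by simp)] at he
      have he' : (symProd (Sum.inl k) (Sum.inr k)).1 p p - (symProd (Sum.inl k) (Sum.inr k)).1 q q =
          (symProd (Sum.inl k) (Sum.inr k)).1 α.fst α.fst +
            (symProd (Sum.inl k) (Sum.inr k)).1 α.snd α.snd :=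
        mul_right_cancel₀ h (by linear_combination he)
      have es : α.snd = Sum.inr α.1.1 := rfl
      simp only [symProd_diag, es] at he'
      rw [← Int.cast_sub, ← Int.cast_add, Int.cast_inj] at he'
      simp only [swap_eq_iff, Sum.swap_inl, Sum.swap_inr]
      linarith)
  rcases hpair with ⟨h1, h2⟩ | ⟨h1, h2⟩
  · exact Or.inl ⟨h1, (swap_eq_iff _ _).1 h2⟩
  · exact Or.inr ⟨h1, (swap_eq_iff _ _).1 h2⟩

/-- The model root vector of weight `-α`. -/
def PosRoot.vec (α : PosRoot n) : nMinus n := negProd α.fst α.snd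

theorem PosRoot.vec_apply_ne_zero (α : PosRoot n) : α.vec.1.1 α.fst α.snd.swap ≠ 0 := by
  have h : α.vec.1 = symProd α.fst α.snd := coe_negProd α.pos_add_pos
  rw [h, symProd_apply, if_pos rfl, if_pos rfl, PosRoot.snd]
  split_ifs with h1 h2
  · rw [h1]; simp [sgn]
  · simp [sgn]
  · simp [sgn]

theorem sp_swap (X : Sp n) (a b : Fin n ⊕ Fin n) :
    sgn b * X.1 b a.swap = sgn a * X.1 a b.swap := by
  have := (mem_sp_iff_swap X.1).1 X.2 a.swap b.swap
  rw [Sum.swap_swap, Sum.swap_swap, sgn_swap] at this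
  linear_combination this

/-- Root spaces are one-dimensional: at most two entries are nonzero, and `sp_swap` ties them
together. -/
theorem exists_smul_vec {f : PosRoot n → nMinus n} (hf : IsRootVectors f) (α : PosRoot n) :
    ∃ c : ℂ, c ≠ 0 ∧ f α = c • α.vec := by
  have hne := α.vec_apply_ne_zero
  have h : f α = ((f α).1.1 α.fst α.snd.swap / α.vec.1.1 α.fst α.snd.swap) • α.vec := by
    ext p q
    change (f α).1.1 p q = _ * α.vec.1.1 p q
    by_cases h1 : p = α.fst ∧ q = α.snd.swap
    · rw [h1.1, h1.2, div_mul_cancel₀ _ hne]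
    by_cases h2 : p = α.snd ∧ q = α.fst.swap
    · have e1 := sp_swap (f α).1 α.fst α.snd
      have e2 := sp_swap α.vec.1 α.fst α.snd
      rw [h2.1, h2.2]
      have hs := sgn_mul_self α.snd
      field_simp
      linear_combination (sgn α.snd * α.vec.1.1 α.fst α.snd.swap) * e1 -
        (sgn α.snd * (f α).1.1 α.fst α.snd.swap) * e2 - ((f α).1.1 α.snd α.fst.swap *
        α.vec.1.1 α.fst α.snd.swap - (f α).1.1 α.fst α.snd.swap * α.vec.1.1 α.snd α.fst.swap) * hs
    · have hf0 : (f α).1.1 p q = 0 := by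
        by_contra hc
        exact (rootVector_entry hf α hc).elim h1 h2
      have hv : α.vec.1 = symProd α.fst α.snd := coe_negProd α.pos_add_pos
      rw [hf0, hv, symProd_apply α.fst α.snd p q, ← ite_and, ← ite_and, if_neg h1, if_neg h2,
        add_zero, mul_zero]
  refine ⟨_, fun hc => hf.ne_zero α ?_, h⟩
  rw [h, hc, zero_smul]

/-- The factor `1/2` compensates for the unordered pair `{a, b}` being met as `(a, b)` and as `(b,
a)`; for `a = b` the product itself has a doubled entry. -/
theorem nMinus_eq_sum (x : nMinus n) :
    x = ∑ a, ∑ b, (2⁻¹ * (sgn b * x.1.1 a b.swap)) • negProd a b := by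
  have h : (x : Sp n) = ∑ a, ∑ b, (2⁻¹ * (sgn b * x.1.1 a b.swap)) • symProd a b := by
    ext p q
    change _ = entry p q _
    simp only [map_sum, map_smul, smul_eq_mul]
    change _ = ∑ a, ∑ b, _ * (symProd a b).1 p q
    have hc : ∀ (P : Prop) [Decidable P] (F : Fin n ⊕ Fin n → ℂ),
        (∑ c, if P then F c else 0) = if P then ∑ c, F c else 0 := fun P _ F => by
      split_ifs <;> simp
    have hq : ∀ y : Fin n ⊕ Fin n, q = y.swap ↔ y = q.swap := fun y =>
      ⟨fun h => by rw [h, Sum.swap_swap], fun h => by rw [h, Sum.swap_swap]⟩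
    simp only [symProd_apply, hq, mul_add, mul_ite, mul_zero, Finset.sum_add_distrib, hc,
      Finset.sum_ite_eq, Finset.sum_ite_eq', Finset.mem_univ, if_true, Sum.swap_swap]
    have h1 := sp_swap x.1 q.swap p
    rw [Sum.swap_swap] at h1
    have h2 := sgn_mul_self q.swap
    have h3 := sgn_mul_self p
    linear_combination (-2⁻¹ * x.1.1 p q) * h2 - 2⁻¹ * x.1.1 p q * h3 + 2⁻¹ * sgn p * h1
  have h' : projMinus n (x : Sp n) = x := by
    ext p q
    rw [projMinus_apply]
    split_ifs with hpq
    · rfl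
    · exact (x.2 p q (not_lt.1 hpq)).symm
  rw [← h']
  conv_lhs => rw [h]
  simp only [map_sum, map_smul, h', negProd]

theorem negProd_eq_vec {a b : Fin n ⊕ Fin n} (h : 0 < pos a + pos b) :
    ∃ α : PosRoot n, negProd a b = α.vec := by
  rcases le_total (pos a) (pos b) with hab | hab
  · obtain ⟨α, h1, h2⟩ := PosRoot.exists_fst_snd h hab
    exact ⟨α, by rw [PosRoot.vec, h1, h2]⟩
  · obtain ⟨α, h1, h2⟩ := PosRoot.exists_fst_snd (by omega) hab
    exact ⟨α, by rw [PosRoot.vec, h1, h2, negProd_comm]⟩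

theorem mem_span_rootVectors {f : PosRoot n → nMinus n} (hf : IsRootVectors f) (x : nMinus n) :
    x ∈ Submodule.span ℂ (Set.range f) := by
  rw [nMinus_eq_sum x]
  refine Submodule.sum_mem _ fun a _ => Submodule.sum_mem _ fun b _ => Submodule.smul_mem _ _ ?_
  by_cases h : 0 < pos a + pos b
  · obtain ⟨α, hα⟩ := negProd_eq_vec h
    obtain ⟨c, hc, hfc⟩ := exists_smul_vec hf α
    have : negProd a b = c⁻¹ • f α := by rw [hfc, smul_smul, inv_mul_cancel₀ hc, one_smul, hα]
    rw [this]
    exact Submodule.smul_mem _ _ (Submodule.subset_span ⟨α, rfl⟩)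
  · rw [negProd_eq_zero (not_lt.1 h)]
    exact zero_mem _

end RootVectors

/-! ### Straightening -/

section Straightening

open MvPolynomial

variable {n : ℕ}

theorem actSym_apply (e : nPlus n) (p : SymMinus n) :
    actSym n e p = symDer (actMinus n e) p := rfl

/-- The generating set is `n⁺`-stable by construction, and the Leibniz rule extends this to the
ideal. -/
theorem actSym_mem_idealI {f : PosRoot n → nMinus n} {m : Fin n → ℕ} (e : nPlus n)
    {q : SymMinus n} (hq : q ∈ idealI f m) : actSym n e q ∈ idealI f m := by
  rw [idealI, ← Ideal.submodule_span_eq] at hq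
  induction hq using Submodule.span_induction with
  | mem q hq =>
    obtain ⟨u, r, hr, rfl⟩ := hq
    refine Ideal.subset_span ⟨UniversalEnvelopingAlgebra.ι ℂ e * u, r, hr, ?_⟩
    rw [map_mul, Module.End.mul_apply]
    congr 1
    exact (UniversalEnvelopingAlgebra.lift_ι_apply' ℂ (actSym n) e).symm
  | zero => rw [map_zero]; exact zero_mem _
  | add a b _ _ ha hb => rw [map_add]; exact add_mem ha hb
  | smul c a ha' ha =>
    rw [actSym_apply, smul_eq_mul, Derivation.leibniz, ← actSym_apply]
    refine add_mem (Ideal.mul_mem_left _ _ ha) ?_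
    rw [smul_eq_mul]
    exact Ideal.mul_mem_right _ _ ha'

/-- The sum of the variables which belong to the root vector `x_a x_b`. -/
def pairVar (a b : Fin n ⊕ Fin n) : MvPolynomial (PosRoot n) ℕ :=
  ∑ β ∈ Finset.univ.filter fun β : PosRoot n =>
    (β.fst = a ∧ β.snd = b) ∨ (β.fst = b ∧ β.snd = a), X β

theorem pairVar_comm (a b : Fin n ⊕ Fin n) : pairVar a b = pairVar b a := by
  simp only [pairVar, or_comm]

/-- The model of the action of `lower v k`. -/
def lowerDer (v k : Fin n ⊕ Fin n) :
    Derivation ℕ (MvPolynomial (PosRoot n) ℕ) (MvPolynomial (PosRoot n) ℕ) :=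
  mkDerivation ℕ fun α => (if α.fst = v then pairVar k α.snd else 0) +
    (if α.snd = v then pairVar α.fst k else 0)

/-- The evaluation of the model polynomials at the model root vectors. -/
def toSym (n : ℕ) : MvPolynomial (PosRoot n) ℕ →ₐ[ℕ] SymMinus n :=
  aeval fun α => SymmetricAlgebra.ι ℂ (nMinus n) α.vec

theorem toSym_pairVar (a b : Fin n ⊕ Fin n) :
    toSym n (pairVar a b) = SymmetricAlgebra.ι ℂ (nMinus n) (negProd a b) := by
  wlog hab : pos a ≤ pos b generalizing a b
  · rw [pairVar_comm, negProd_comm]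
    exact this b a (le_of_not_ge hab)
  rw [pairVar, map_sum]
  by_cases h : 0 < pos a + pos b
  · obtain ⟨α, rfl, rfl⟩ := PosRoot.exists_fst_snd h hab
    rw [Finset.sum_eq_single α]
    · rw [toSym, aeval_X]
      rfl
    · intro β hβ hne
      exfalso
      rcases (Finset.mem_filter.1 hβ).2 with ⟨h1, h2⟩ | ⟨h1, h2⟩
      · exact hne (PosRoot.ext_fst_snd h1 h2)
      · have h3 := β.pos_fst_le
        rw [h1, h2] at h3
        have h4 := pos_injective (le_antisymm h3 hab)
        exact hne (PosRoot.ext_fst_snd (h1.trans h4) (h2.trans h4.symm))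
    · simp
  · rw [negProd_eq_zero (not_lt.1 h), map_zero]
    refine Finset.sum_eq_zero fun β hβ => absurd β.pos_add_pos ?_
    rcases (Finset.mem_filter.1 hβ).2 with ⟨h1, h2⟩ | ⟨h1, h2⟩ <;> rw [h1, h2] <;> omega

/-- The roots all of whose basis vectors are at most `v`. -/
def rootsBelow (v : Fin n ⊕ Fin n) : Set (PosRoot n) := {α | pos α.snd ≤ pos v}

theorem pairVar_mem_supported {v a b : Fin n ⊕ Fin n} (ha : pos a ≤ pos v) (hb : pos b ≤ pos v) :
    pairVar a b ∈ supported ℕ (rootsBelow v) := by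
  refine sum_mem fun β hβ => X_mem_supported.2 ?_
  change pos β.snd ≤ pos v
  rcases (Finset.mem_filter.1 hβ).2 with ⟨h1, h2⟩ | ⟨h1, h2⟩ <;> rw [h2] <;> assumption

theorem map_derivation_mul {A B : Type*} [CommSemiring A] [CommRing B] [Algebra ℂ B]
    (φ : A →+* B) [Algebra ℕ A] (D : Derivation ℕ A A) (D' : Derivation ℂ B B) {p q : A}
    (hp : φ (D p) = D' (φ p)) (hq : φ (D q) = D' (φ q)) : φ (D (p * q)) = D' (φ (p * q)) := by
  simp only [Derivation.leibniz, map_mul, smul_eq_mul, map_add, hp, hq]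

/-- The model over `ℕ` is faithful only on `rootsBelow v`; since lowering stays there, words in
these operators can be followed letter by letter. -/
theorem lowerDer_mem_supported {v k : Fin n ⊕ Fin n} (h : pos k < pos v)
    {p : MvPolynomial (PosRoot n) ℕ} (hp : p ∈ supported ℕ (rootsBelow v)) :
    lowerDer v k p ∈ supported ℕ (rootsBelow v) ∧
      toSym n (lowerDer v k p) = actSym n (lower v k h) (toSym n p) := by
  induction hp using Algebra.adjoin_induction with
  | mem p hp =>
    obtain ⟨α, hα, rfl⟩ := hp
    have hα' : pos α.snd ≤ pos v := hα
    have h1 := α.pos_fst_le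
    rw [lowerDer, mkDerivation_X]
    constructor
    · refine add_mem ?_ ?_ <;> split_ifs
      · exact pairVar_mem_supported h.le hα'
      · exact zero_mem _
      · exact pairVar_mem_supported (h1.trans hα') h.le
      · exact zero_mem _
    · rw [toSym, aeval_X, ← toSym, actSym_apply, symDer_ι, PosRoot.vec,
        actMinus_lower_of_le h (h1.trans hα') hα']
      simp only [map_add, apply_ite (toSym n), toSym_pairVar, map_zero,
        apply_ite (SymmetricAlgebra.ι ℂ (nMinus n))]
  | algebraMap r =>
    rw [eq_natCast, Derivation.map_natCast]
    refine ⟨zero_mem _, ?_⟩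
    rw [map_natCast, map_zero, actSym_apply]
    exact (Derivation.map_natCast _ r).symm
  | add p q _ _ hp hq =>
    simp only [map_add]
    exact ⟨add_mem hp.1 hq.1, by rw [hp.2, hq.2]⟩
  | mul p q hp' hq' hp hq =>
    refine ⟨?_, map_derivation_mul (toSym n).toRingHom (lowerDer v k)
      (symDer (actMinus n (lower v k h))) hp.2 hq.2⟩
    rw [Derivation.leibniz]
    exact add_mem (mul_mem hp' hq.1) (mul_mem hq' hp.1)

theorem isWeightedHomogeneous_pairVar (a b : Fin n ⊕ Fin n) :
    IsWeightedHomogeneous PosRoot.content (pairVar a b) (Pi.single a 1 + Pi.single b 1) := by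
  refine IsWeightedHomogeneous.sum _ _ _ fun β hβ => ?_
  have : Pi.single a 1 + Pi.single b 1 = β.content := by
    rcases (Finset.mem_filter.1 hβ).2 with ⟨h1, h2⟩ | ⟨h1, h2⟩ <;> rw [PosRoot.content, h1, h2]
    rw [add_comm]
  rw [this]
  exact isWeightedHomogeneous_X _ _ _

theorem isWeightedHomogeneous_lowerDer (v k : Fin n ⊕ Fin n) {p : MvPolynomial (PosRoot n) ℕ}
    {c : Fin n ⊕ Fin n → ℤ} (hp : IsWeightedHomogeneous PosRoot.content p c) :
    IsWeightedHomogeneous PosRoot.content (lowerDer v k p)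
      (c + (Pi.single k 1 - Pi.single v 1)) := by
  refine isWeightedHomogeneous_mkDerivation (fun α => IsWeightedHomogeneous.add ?_ ?_) hp
  · split_ifs with h
    · have e : α.content + (Pi.single k 1 - Pi.single v 1) =
          Pi.single k 1 + Pi.single α.snd 1 := by rw [PosRoot.content, h]; abel
      rw [e]
      exact isWeightedHomogeneous_pairVar _ _
    · exact isWeightedHomogeneous_zero _ _ _
  · split_ifs with h
    · have e : α.content + (Pi.single k 1 - Pi.single v 1) =
          Pi.single α.fst 1 + Pi.single k 1 := by rw [PosRoot.content, h]; abel
      rw [e]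
      exact isWeightedHomogeneous_pairVar _ _
    · exact isWeightedHomogeneous_zero _ _ _

theorem X_dominated_pairVar (α : PosRoot n) :
    Dominated (X α) (pairVar α.fst α.snd) :=
  Dominated.sum (A := MvPolynomial (PosRoot n) ℕ) (s := Finset.univ.filter fun β : PosRoot n =>
    (β.fst = α.fst ∧ β.snd = α.snd) ∨ (β.fst = α.snd ∧ β.snd = α.fst)) (i := α)
    (Finset.mem_filter.2 ⟨Finset.mem_univ α, Or.inl ⟨rfl, rfl⟩⟩) X

/-- Domination rather than equality: if `a = v`, the Leibniz rule lowers the other factor as well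
and gives a further nonnegative term. -/
theorem pairVar_dominated_lowerDer {a v : Fin n ⊕ Fin n} (k : Fin n ⊕ Fin n)
    (h : 0 < pos a + pos v) (hav : pos a ≤ pos v) :
    Dominated (pairVar a k) (lowerDer v k (pairVar a v)) := by
  obtain ⟨β, rfl, rfl⟩ := PosRoot.exists_fst_snd h hav
  refine Dominated.trans ?_ ((X_dominated_pairVar β).map (lowerDer β.snd k))
  rw [lowerDer, mkDerivation_X, if_pos rfl, add_comm]
  exact ⟨_, rfl⟩

/-- Lower the second basis vector of the start `x_u x_v`. -/
theorem exists_word_snd {v : Fin n ⊕ Fin n} {α : PosRoot n} (h : α ∈ rootsBelow v) :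
    ∃ l : List (Fin n ⊕ Fin n), (∀ k ∈ l, pos k < pos v) ∧
      Dominated (X α) (word (lowerDer v) l (pairVar α.fst v)) := by
  have h' : pos α.snd ≤ pos v := h
  rcases h'.eq_or_lt with he | hlt
  · refine ⟨[], by simp, ?_⟩
    rw [← pos_injective he]
    exact X_dominated_pairVar α
  · refine ⟨[α.snd], by simpa using hlt, (X_dominated_pairVar α).trans ?_⟩
    have h1 := α.pos_add_pos
    have h2 := α.pos_fst_le
    exact pairVar_dominated_lowerDer α.snd (by omega) (by omega)

/-- Lower both basis vectors of the start `x_v x_v`. -/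
theorem exists_word_fst_snd {v : Fin n ⊕ Fin n} {α : PosRoot n} (h : α ∈ rootsBelow v) :
    ∃ l : List (Fin n ⊕ Fin n), (∀ k ∈ l, pos k < pos v) ∧
      Dominated (X α) (word (lowerDer v) l (pairVar v v)) := by
  obtain ⟨l, hl, hd⟩ := exists_word_snd h
  have h' : pos α.snd ≤ pos v := h
  have h2 := α.pos_fst_le
  have h3 := α.pos_add_pos
  rcases (h2.trans h').eq_or_lt with he | hlt
  · refine ⟨l, hl, ?_⟩
    rwa [pos_injective he] at hd
  -- The last letter of a word acts first: one copy of `v` is lowered to `α.fst`, and then `l`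
  -- lowers the other to `α.snd`.
  · refine ⟨l ++ [α.fst], fun k hk => ?_, hd.trans ?_⟩
    · rcases List.mem_append.1 hk with hk | hk
      · exact hl k hk
      · rw [List.mem_singleton.1 hk]; exact hlt
    · rw [word_append, pairVar_comm]
      exact (pairVar_dominated_lowerDer α.fst (by omega) le_rfl).word _ l

/-- The monomials in the model root vectors. -/
theorem toSym_monomial (s : PosRoot n →₀ ℕ) :
    toSym n (monomial s 1) = mon PosRoot.vec s := by
  rw [toSym, aeval_monomial, map_one, one_mul, mon]

theorem prod_map_toMultiset {ι A : Type*} [CommMonoid A] (g : ι → A) (s : ι →₀ ℕ) :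
    ((Finsupp.toMultiset s).map g).prod = s.prod fun a k => g a ^ k := by
  classical
  induction s using Finsupp.induction_linear with
  | zero => simp
  | add a b ha hb =>
    rw [map_add, Multiset.map_add, Multiset.prod_add, ha, hb,
      Finsupp.prod_add_index' (by simp) (by simp [pow_add])]
  | single a k => simp [Finsupp.toMultiset_single, Multiset.map_nsmul, Multiset.prod_nsmul]

/-- Lowering a product of starting vectors in an ideal which is stable under `n⁺`. -/
theorem exists_straightening {v : Fin n ⊕ Fin n} {I : Ideal (SymMinus n)}
    (hI : ∀ (e : nPlus n) (q : SymMinus n), q ∈ I → actSym n e q ∈ I) (s : PosRoot n →₀ ℕ)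
    (st : PosRoot n → Fin n ⊕ Fin n) (hst : ∀ α, s α ≠ 0 → pos (st α) ≤ pos v)
    (hw : ∀ α, s α ≠ 0 → ∃ l : List (Fin n ⊕ Fin n), (∀ k ∈ l, pos k < pos v) ∧
      Dominated (X α) (word (lowerDer v) l (pairVar (st α) v)))
    (hmem : ((Finsupp.toMultiset s).map fun α =>
      SymmetricAlgebra.ι ℂ (nMinus n) (negProd (st α) v)).prod ∈ I) :
    ∃ P : MvPolynomial (PosRoot n) ℕ, toSym n P ∈ I ∧ coeff s P ≠ 0 ∧
      ∀ t ∈ P.support, Finsupp.weight PosRoot.content t = Finsupp.weight PosRoot.content s := by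
  have hsupp : ∀ α ∈ Finsupp.toMultiset s, s α ≠ 0 := fun α hα => by
    rwa [Finsupp.mem_toMultiset, Finsupp.mem_support_iff] at hα
  obtain ⟨l, hl, hd⟩ := exists_word_prod (lowerDer v) {k | pos k < pos v} X
    (fun α => pairVar (st α) v) (Finsupp.toMultiset s) fun α hα => hw α (hsupp α hα)
  set Q := ((Finsupp.toMultiset s).map fun α => pairVar (st α) v).prod with hQ
  have hQs : Q ∈ supported ℕ (rootsBelow v) := by
    refine Subalgebra.multiset_prod_mem _ fun p hp => ?_
    obtain ⟨α, hα, rfl⟩ := Multiset.mem_map.1 hp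
    exact pairVar_mem_supported (hst α (hsupp α hα)) le_rfl
  have hQI : toSym n Q ∈ I := by
    rw [hQ, map_multiset_prod, Multiset.map_map]
    simpa only [Function.comp_def, toSym_pairVar] using hmem
  have hQw : ∃ c, IsWeightedHomogeneous PosRoot.content Q c := by
    rw [hQ]
    generalize Finsupp.toMultiset s = S
    induction S using Multiset.induction with
    | empty => exact ⟨0, by simpa using isWeightedHomogeneous_one _ _⟩
    | cons a S ih =>
      obtain ⟨c, hc⟩ := ih
      rw [Multiset.map_cons, Multiset.prod_cons]
      exact ⟨_, (isWeightedHomogeneous_pairVar _ _).mul hc⟩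
  -- Support below `v` is carried through the induction because it is what identifies the model
  -- operator with the action of `n⁺`, under which `I` is stable.
  have hword : word (lowerDer v) l Q ∈ supported ℕ (rootsBelow v) ∧
      toSym n (word (lowerDer v) l Q) ∈ I ∧
      ∃ c, IsWeightedHomogeneous PosRoot.content (word (lowerDer v) l Q) c := by
    clear hd
    induction l with
    | nil => exact ⟨hQs, hQI, hQw⟩
    | cons k l ih =>
      obtain ⟨h1, h2, c, h3⟩ := ih fun j hj => hl j (List.mem_cons_of_mem _ hj)
      have h4 := lowerDer_mem_supported (hl k List.mem_cons_self) h1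
      refine ⟨h4.1, ?_, _, isWeightedHomogeneous_lowerDer v k h3⟩
      change toSym n (lowerDer v k (word (lowerDer v) l Q)) ∈ I
      rw [h4.2]
      exact hI _ _ h2
  obtain ⟨-, h2, c, h3⟩ := hword
  -- Over `ℕ` the remainder of the domination cannot cancel the monomial of `s`.
  have hcoeff : coeff s (word (lowerDer v) l Q) ≠ 0 := by
    obtain ⟨r, hr⟩ := hd
    rw [hr, coeff_add, prod_map_toMultiset]
    have : (s.prod fun a k => (X a : MvPolynomial (PosRoot n) ℕ) ^ k) = monomial s 1 := by
      rw [monomial_eq, map_one, one_mul]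
    rw [this, coeff_monomial, if_pos rfl]
    omega
  exact ⟨_, h2, hcoeff, fun t ht => (h3 (mem_support_iff.1 ht)).trans (h3 hcoeff).symm⟩

/-- `D` turns one factor `y w` into `y a`, and every choice of the factor gives the same product.
The image is thus a multiple of the target by the number of factors `y w`, a positive integer that
is invertible in `ℂ`. -/
theorem mul_prod_mem_of_derivation {A τ : Type*} [CommRing A] [Algebra ℂ A] [DecidableEq τ]
    (D : Derivation ℂ A A) {y : τ → A} {a w : τ} (hD : ∀ b, D (y b) = if b = w then y a else 0)
    {I : Ideal A} (hI : ∀ q ∈ I, D q ∈ I) (S : Multiset τ) (r : ℕ)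
    (h : y w ^ (r + 1) * (S.map y).prod ∈ I) : y w ^ r * (y a * (S.map y).prod) ∈ I := by
  have hD' : y w * D (S.map y).prod = (Multiset.count w S : A) * (y a * (S.map y).prod) := by
    clear h
    induction S using Multiset.induction with
    | empty => simp
    | cons b T ih =>
      have e1 : y w * D ((b ::ₘ T).map y).prod =
          y b * (y w * D (T.map y).prod) + y w * ((T.map y).prod * if b = w then y a else 0) := by
        rw [Multiset.map_cons, Multiset.prod_cons, Derivation.leibniz, hD, smul_eq_mul,
          smul_eq_mul, mul_add, mul_left_comm]
      rw [e1, ih, Multiset.count_cons, Multiset.map_cons, Multiset.prod_cons]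
      by_cases hb : b = w
      · rw [if_pos hb, if_pos hb.symm, hb]
        push_cast
        ring
      · rw [if_neg hb, if_neg (Ne.symm hb)]
        push_cast
        ring
  have h2 := hI _ h
  rw [Derivation.leibniz, Derivation.leibniz_pow, hD, if_pos rfl, pow_succ,
    Nat.add_sub_cancel] at h2
  have h3 : (y w ^ r * y w) • D (S.map y).prod + (S.map y).prod • (r + 1) • y w ^ r • y a =
      ((Multiset.count w S + r + 1 : ℕ) : ℂ) • (y w ^ r * (y a * (S.map y).prod)) := by
    rw [smul_eq_mul, mul_assoc, hD', Nat.cast_smul_eq_nsmul, nsmul_eq_mul, nsmul_eq_mul,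
      smul_eq_mul, smul_eq_mul]
    push_cast
    ring
  rw [h3] at h2
  have h4 : ((Multiset.count w S + r + 1 : ℕ) : ℂ) ≠ 0 := Nat.cast_ne_zero.2 (by omega)
  have h5 := Submodule.smul_of_tower_mem I ((Multiset.count w S + r + 1 : ℕ) : ℂ)⁻¹ h2
  rwa [smul_smul, inv_mul_cancel₀ h4, one_smul] at h5

/-- The first basis vectors of the starting vectors `x_w x_{i*}` can be lowered independently. -/
theorem prod_mem_of_pow_mem {i w : Fin n} {I : Ideal (SymMinus n)}
    (hI : ∀ (e : nPlus n) (q : SymMinus n), q ∈ I → actSym n e q ∈ I) (S : Multiset (Fin n))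
    (hS : ∀ a ∈ S, i < a ∧ a ≤ w) (r : ℕ)
    (hmem : SymmetricAlgebra.ι ℂ (nMinus n) (negProd (Sum.inl w) (Sum.inr i)) ^
      (r + Multiset.card S) ∈ I) :
    SymmetricAlgebra.ι ℂ (nMinus n) (negProd (Sum.inl w) (Sum.inr i)) ^ r *
      (S.map fun a => SymmetricAlgebra.ι ℂ (nMinus n) (negProd (Sum.inl a) (Sum.inr i))).prod
        ∈ I := by
  classical
  set y : Fin n → SymMinus n := fun a =>
    SymmetricAlgebra.ι ℂ (nMinus n) (negProd (Sum.inl a) (Sum.inr i)) with hy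
  change y w ^ (r + Multiset.card S) ∈ I at hmem
  change y w ^ r * (S.map y).prod ∈ I
  induction S using Multiset.induction generalizing r with
  | empty => simpa using hmem
  | cons a S ih =>
    have h1 := ih (fun b hb => hS b (Multiset.mem_cons_of_mem hb)) (r + 1) (by
      rw [Multiset.card_cons] at hmem
      rwa [add_assoc, add_comm 1])
    rw [Multiset.map_cons, Multiset.prod_cons]
    obtain ⟨hia, haw⟩ := hS a (Multiset.mem_cons_self a S)
    rcases haw.eq_or_lt with rfl | haw
    · rwa [pow_succ, mul_assoc] at h1
    have hpos : pos (n := n) (Sum.inl a) < pos (n := n) (Sum.inl w) := by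
      simp only [pos]
      have : (a : ℕ) < w := haw
      omega
    set e := lower (Sum.inl w) (Sum.inl a) hpos
    -- The other effect of `e` is on `x_{a*}`, which differs from `x_{i*}` because `i < a`.
    have hD : ∀ b, symDer (actMinus n e) (y b) = if b = w then y a else 0 := fun b => by
      rw [hy, symDer_ι, actMinus_lower]
      simp only [Sum.swap_inl, Sum.inl.injEq, reduceCtorEq, if_false, Sum.inr.injEq, hia.ne,
        add_zero]
      split_ifs <;> simp
    exact mul_prod_mem_of_derivation _ hD (fun q hq => hI e q hq) S r h1

end Straightening

/-! ### The straightening law -/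

section StraighteningLaw

open MvPolynomial

variable {n : ℕ}

theorem card_toMultiset_eq_degree {σ : Type*} (s : σ →₀ ℕ) :
    Multiset.card (Finsupp.toMultiset s) = s.degree := by
  rw [Finsupp.card_toMultiset]
  rfl

theorem mon_add (f : PosRoot n → nMinus n) (s t : PosRoot n →₀ ℕ) :
    mon f (s + t) = mon f s * mon f t :=
  Finsupp.prod_add_index' (by simp) (by simp [pow_add])

theorem mon_smul {f g : PosRoot n → nMinus n} {c : PosRoot n → ℂ} (h : ∀ α, f α = c α • g α)
    (s : PosRoot n →₀ ℕ) : mon f s = (s.prod fun α k => c α ^ k) • mon g s := by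
  rw [mon, mon, Algebra.smul_def, map_finsuppProd, ← Finsupp.prod_mul]
  refine Finsupp.prod_congr fun α _ => ?_
  rw [h, map_smul, Algebra.smul_def, mul_pow, map_pow]

/-- A straightening law for the multi-exponent `s`. -/
def HasStraightening (f : PosRoot n → nMinus n) (I : Ideal (SymMinus n)) (s : PosRoot n →₀ ℕ) :
    Prop :=
  ∃ c : (PosRoot n →₀ ℕ) →₀ ℂ,
    (∀ t ∈ c.support, (rootLex n).toSyn t < (rootLex n).toSyn s ∧ t.degree = s.degree) ∧
    mon f s - c.sum (fun t a => a • mon f t) ∈ I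

theorem HasStraightening.add {f : PosRoot n → nMinus n} {I : Ideal (SymMinus n)}
    {s : PosRoot n →₀ ℕ} (h : HasStraightening f I s) (t : PosRoot n →₀ ℕ) :
    HasStraightening f I (s + t) := by
  classical
  obtain ⟨c, hc, hI⟩ := h
  refine ⟨c.mapDomain (· + t), fun u hu => ?_, ?_⟩
  · obtain ⟨r, hr, rfl⟩ := Finset.mem_image.1 (Finsupp.mapDomain_support hu)
    obtain ⟨h1, h2⟩ := hc r hr
    rw [map_add, map_add, map_add, map_add, h2]
    exact ⟨by simpa using h1, rfl⟩
  · have e : mon f (s + t) - (c.mapDomain (· + t)).sum (fun u a => a • mon f u) =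
        mon f t * (mon f s - c.sum (fun u a => a • mon f u)) := by
      rw [Finsupp.sum_mapDomain_index (by simp) (by simp [add_smul]), mul_sub, mon_add,
        mul_comm (mon f s), Finsupp.mul_sum]
      simp only [mon_add, smul_mul_assoc, mul_comm (mon f t)]
    rw [e]
    exact I.mul_mem_left _ hI

/-- Solve the relation for the monomial of `s`: the chain condition makes it the leading one, and
equal content gives equal degree. The scalars `K t` pass between the given root vectors and those of
the model. -/
theorem hasStraightening_of_toSym_mem {f : PosRoot n → nMinus n} (hf : IsRootVectors f)
    {I : Ideal (SymMinus n)} {s : PosRoot n →₀ ℕ}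
    (hs : ∀ α β, s α ≠ 0 → s β ≠ 0 → (α.1.1 : ℕ) < β.1.1 → (α.1.2 : ℕ) ≤ β.1.2)
    {P : MvPolynomial (PosRoot n) ℕ} (hP : toSym n P ∈ I) (h0 : coeff s P ≠ 0)
    (hw : ∀ t ∈ P.support,
      Finsupp.weight PosRoot.content t = Finsupp.weight PosRoot.content s) :
    HasStraightening f I s := by
  classical
  choose κ hκ hfκ using exists_smul_vec hf
  set K : (PosRoot n →₀ ℕ) → ℂ := fun t => t.prod fun α k => κ α ^ k with hK
  have hK0 : ∀ t, K t ≠ 0 := fun t => Finsupp.prod_ne_zero_iff.2 fun α _ => pow_ne_zero _ (hκ α)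
  set d : (PosRoot n →₀ ℕ) → ℂ := fun t => ((coeff t P : ℕ) : ℂ) * (K t)⁻¹ with hd
  have hds : d s ≠ 0 := mul_ne_zero (Nat.cast_ne_zero.2 h0) (inv_ne_zero (hK0 s))
  have hsum : toSym n P = ∑ t ∈ P.support, d t • mon f t := by
    conv_lhs => rw [P.as_sum, map_sum]
    refine Finset.sum_congr rfl fun t _ => ?_
    have e : (monomial t (coeff t P) : MvPolynomial (PosRoot n) ℕ) =
        coeff t P • monomial t 1 := by rw [smul_monomial, smul_eq_mul, mul_one]
    rw [e, map_nsmul, toSym_monomial, mon_smul hfκ, smul_smul]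
    change _ = (((coeff t P : ℕ) : ℂ) * (K t)⁻¹ * K t) • _
    rw [mul_assoc, inv_mul_cancel₀ (hK0 t), mul_one, Nat.cast_smul_eq_nsmul]
  refine ⟨Finsupp.onFinset (P.support.erase s)
    (fun t => if t ∈ P.support.erase s then -((d s)⁻¹ * d t) else 0) (fun t ht => ?_),
    fun t ht => ?_, ?_⟩
  · by_contra hc
    exact ht (if_neg hc)
  · have h1 := Finset.mem_erase.1 (Finsupp.support_onFinset_subset ht)
    exact ⟨rootLex_lt_of_chain hs (hw t h1.2) h1.1, degree_eq_of_weight_content (hw t h1.2)⟩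
  · rw [Finsupp.onFinset_sum _ (by simp)]
    have e : mon f s - ∑ t ∈ P.support.erase s,
        (if t ∈ P.support.erase s then -((d s)⁻¹ * d t) else 0) • mon f t =
        (d s)⁻¹ • toSym n P := by
      rw [hsum, ← Finset.add_sum_erase _ _ (mem_support_iff.2 h0), smul_add, smul_smul,
        inv_mul_cancel₀ hds, one_smul, sub_eq_add_neg, ← Finset.sum_neg_distrib, Finset.smul_sum]
      congr 1
      refine Finset.sum_congr rfl fun t ht => ?_
      rw [if_pos ht, neg_smul, neg_neg, smul_smul]
    rw [e]
    exact Submodule.smul_of_tower_mem I _ hP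

theorem pow_mem_idealI {f : PosRoot n → nMinus n} (hf : IsRootVectors f) {m : Fin n → ℕ}
    {α : PosRoot n} {M d : ℕ}
    (h : SymmetricAlgebra.ι ℂ (nMinus n) (f α) ^ (M + 1) ∈ rootPowers f m) (hd : M < d) :
    SymmetricAlgebra.ι ℂ (nMinus n) α.vec ^ d ∈ idealI f m := by
  obtain ⟨c, hc, hfc⟩ := exists_smul_vec hf α
  have h1 : SymmetricAlgebra.ι ℂ (nMinus n) (f α) ^ (M + 1) ∈ idealI f m :=
    Ideal.subset_span ⟨1, _, Submodule.subset_span h, by rw [map_one, Module.End.one_apply]⟩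
  have h2 := (idealI f m).mul_mem_left (SymmetricAlgebra.ι ℂ (nMinus n) (f α) ^ (d - (M + 1))) h1
  rw [← pow_add, Nat.sub_add_cancel hd, hfc, map_smul, smul_pow] at h2
  have h3 := Submodule.smul_of_tower_mem (idealI f m) (c ^ d)⁻¹ h2
  rwa [smul_smul, inv_mul_cancel₀ (pow_ne_zero _ hc), one_smul] at h3

/-- The start is a power of `x_{i*} x_{i*}`. All roots with first index at least `i` consist of
vectors not later than `i*`, so both factors can be lowered in the positive model. -/
theorem hasStraightening_of_long {f : PosRoot n → nMinus n} (hf : IsRootVectors f)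
    {m : Fin n → ℕ} {s : PosRoot n →₀ ℕ}
    (hs : ∀ α β, s α ≠ 0 → s β ≠ 0 → (α.1.1 : ℕ) < β.1.1 → (α.1.2 : ℕ) ≤ β.1.2)
    (i : Fin n) (hi : ∀ α, s α ≠ 0 → (i : ℕ) ≤ α.1.1)
    (hd : ∑ l ∈ Finset.Ici i, m l < s.degree) :
    HasStraightening f (idealI f m) s := by
  have hin := i.2
  obtain ⟨β, hβ1, hβ2⟩ : ∃ β : PosRoot n, β.fst = Sum.inr i ∧ β.snd = Sum.inr i :=
    PosRoot.exists_fst_snd (by simp only [pos]; omega) le_rfl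
  have hlong : IsLong β i := by
    have e1 := congrArg pos hβ1
    have e2 := congrArg pos hβ2
    rw [β.pos_fst] at e1
    rw [β.pos_snd] at e2
    simp only [pos] at e1 e2
    have := β.1.2.2; have := β.1.1.2
    refine ⟨Fin.ext (by omega), ?_⟩
    split_ifs at e1 <;> omega
  obtain ⟨P, h1, h2, h3⟩ := exists_straightening (v := Sum.inr i) (I := idealI f m)
    (fun e q hq => actSym_mem_idealI e hq) s (fun _ => Sum.inr i) (fun _ _ => le_rfl)
    (fun α hα => exists_word_fst_snd (by
      have := hi α hα
      change pos α.snd ≤ pos (Sum.inr i)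
      rw [α.pos_snd]
      simp only [pos]
      omega))
    (by
      rw [Multiset.map_const', Multiset.prod_replicate, card_toMultiset_eq_degree]
      have := pow_mem_idealI hf (m := m) (Or.inr ⟨β, i, hlong, rfl⟩) hd
      rwa [PosRoot.vec, hβ1, hβ2] at this)
  exact hasStraightening_of_toSym_mem hf hs h1 h2 h3

/-- The start is a power of `x_w x_{i*}` with `w = j + 1`, lowered in two stages. The first stage
moves the copies of `x_w` and lies outside the positive model, as `i*` is later than `w`; there
`prod_mem_of_pow_mem` computes directly. The second stage lowers the copies of `x_{i*}` within the
model. -/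
theorem hasStraightening_of_short {f : PosRoot n → nMinus n} (hf : IsRootVectors f)
    {m : Fin n → ℕ} {s : PosRoot n →₀ ℕ}
    (hs : ∀ α β, s α ≠ 0 → s β ≠ 0 → (α.1.1 : ℕ) < β.1.1 → (α.1.2 : ℕ) ≤ β.1.2)
    (i j : Fin n) (hij : i ≤ j) (hj : (j : ℕ) + 1 < n)
    (hi : ∀ α, s α ≠ 0 → (i : ℕ) ≤ α.1.1) (hq : ∀ α, s α ≠ 0 → (α.1.2 : ℕ) ≤ j)
    (hd : ∑ l ∈ Finset.Icc i j, m l < s.degree) :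
    HasStraightening f (idealI f m) s := by
  have hij' : (i : ℕ) ≤ j := hij
  set w : Fin n := ⟨j + 1, hj⟩ with hwdef
  have hwv : (w : ℕ) = j + 1 := rfl
  obtain ⟨β, hβ1, hβ2⟩ : ∃ β : PosRoot n, β.fst = Sum.inl w ∧ β.snd = Sum.inr i :=
    PosRoot.exists_fst_snd (by simp only [pos]; omega) (by simp only [pos]; omega)
  have hβ : β.1.1 = i ∧ (β.1.2 : ℕ) = j := by
    have e1 := congrArg pos hβ1
    have e2 := congrArg pos hβ2
    rw [β.pos_fst] at e1
    rw [β.pos_snd] at e2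
    simp only [pos] at e1 e2
    refine ⟨Fin.ext (by omega), ?_⟩
    split_ifs at e1 <;> omega
  have hfst : ∀ α : PosRoot n, s α ≠ 0 → ∃ a : Fin n, α.fst = Sum.inl a ∧ i < a ∧ a ≤ w :=
    fun α hα => by
      have h1 := hq α hα
      have h2 := hi α hα
      have h3 := α.2.1
      refine ⟨⟨α.1.2 + 1, by omega⟩, dif_pos (by omega), ?_, ?_⟩
      · rw [Fin.lt_def]; simp only; omega
      · rw [Fin.le_def]; simp only; omega
  obtain ⟨P, h1, h2, h3⟩ := exists_straightening (v := Sum.inr i) (I := idealI f m)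
    (fun e q hq => actSym_mem_idealI e hq) s PosRoot.fst
    (fun α hα => by
      obtain ⟨a, ha, -⟩ := hfst α hα
      rw [ha]
      simp only [pos]
      have := a.2; have := i.2
      omega)
    (fun α hα => exists_word_snd (by
      have := hi α hα
      change pos α.snd ≤ pos (Sum.inr i)
      rw [α.pos_snd]
      simp only [pos]
      omega))
    (by
      have hpow := pow_mem_idealI hf (m := m) (Or.inl ⟨β, j, hj, hβ.2, rfl⟩) (hβ.1 ▸ hd)
      rw [PosRoot.vec, hβ1, hβ2, ← card_toMultiset_eq_degree] at hpow
      have : Nonempty (Fin n) := ⟨i⟩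
      choose! a ha using hfst
      have hS : ∀ α ∈ Finsupp.toMultiset s, s α ≠ 0 := fun α hα => by
        rwa [Finsupp.mem_toMultiset, Finsupp.mem_support_iff] at hα
      have := prod_mem_of_pow_mem (i := i) (w := w) (I := idealI f m)
        (fun e q hq => actSym_mem_idealI e hq) ((Finsupp.toMultiset s).map a)
        (fun b hb => by
          obtain ⟨α, hα, rfl⟩ := Multiset.mem_map.1 hb
          exact (ha α (hS α hα)).2) 0 (by rwa [zero_add, Multiset.card_map])
      rw [pow_zero, one_mul, Multiset.map_map] at this
      convert this using 2
      refine Multiset.map_congr rfl fun α hα => ?_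
      rw [Function.comp_apply, (ha α (hS α hα)).1])
  exact hasStraightening_of_toSym_mem hf hs h1 h2 h3

/-! ### Violated Dyck path inequalities. -/

theorem Step.le {α β : PosRoot n} (h : Step α β) :
    (α.1.1 : ℕ) ≤ β.1.1 ∧ (α.1.2 : ℕ) ≤ β.1.2 ∧
      (α.1.1 : ℕ) + α.1.2 < (β.1.1 : ℕ) + β.1.2 := by
  rcases h with ⟨h1, h2⟩ | ⟨h1, h2⟩
  · rw [h1]; omega
  · rw [h2]; omega

theorem IsDyckPath.mono {k : ℕ} {p : Fin (k + 1) → PosRoot n} (hp : IsDyckPath p) :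
    Monotone (fun t => ((p t).1.1 : ℕ)) ∧ Monotone (fun t => ((p t).1.2 : ℕ)) ∧
      StrictMono (fun t => ((p t).1.1 : ℕ) + (p t).1.2) :=
  ⟨Fin.monotone_iff_le_succ.2 fun t => (hp.step t).le.1,
    Fin.monotone_iff_le_succ.2 fun t => (hp.step t).le.2.1,
    Fin.strictMono_iff_lt_succ.2 fun t => (hp.step t).le.2.2⟩

theorem hasStraightening {f : PosRoot n → nMinus n} (hf : IsRootVectors f)
    {m : Fin n → ℕ} {s : PosRoot n →₀ ℕ} (hs : s ∉ latticePoints m) :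
    HasStraightening f (idealI f m) s := by
  classical
  have h0 : ¬ ∀ (k : ℕ) (p : Fin (k + 1) → PosRoot n), IsDyckPath p →
      ∀ i j : Fin n, IsSimple (p 0) i →
      (IsSimple (p (Fin.last k)) j → ∑ t, (s (p t) : ℝ) ≤ ∑ l ∈ Finset.Icc i j, (m l : ℝ)) ∧
      (IsLong (p (Fin.last k)) j → ∑ t, (s (p t) : ℝ) ≤ ∑ l ∈ Finset.Ici i, (m l : ℝ)) :=
    fun h => hs ⟨fun α => Nat.cast_nonneg _, h⟩
  push Not at h0
  obtain ⟨k, p, hp, i, j, hi, h⟩ := h0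
  obtain ⟨hm1, hm2, hm3⟩ := hp.mono
  have hinj : Function.Injective p := fun a b hab => hm3.injective (by simp only [hab])
  set s' : PosRoot n →₀ ℕ := s.filter (· ∈ Set.range p) with hs'
  have hsupp : ∀ α, s' α ≠ 0 → ∃ t, p t = α := fun α hα => by
    by_contra hc
    exact hα (Finsupp.filter_apply_neg _ _ hc)
  have hdeg : s'.degree = ∑ t, s (p t) := by
    rw [Finsupp.degree_eq_sum, ← Finset.sum_image (s := Finset.univ) (g := p) (f := s)
      (fun a _ b _ hab => hinj hab)]
    symm
    rw [← Finset.sum_subset (Finset.subset_univ (Finset.univ.image p))]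
    · refine Finset.sum_congr rfl fun α hα => ?_
      obtain ⟨t, -, rfl⟩ := Finset.mem_image.1 hα
      exact (Finsupp.filter_apply_pos _ _ ⟨t, rfl⟩).symm
    · intro α _ hα
      by_contra hc
      obtain ⟨t, rfl⟩ := hsupp α hc
      exact hα (Finset.mem_image_of_mem _ (Finset.mem_univ t))
  have hchain : ∀ α β, s' α ≠ 0 → s' β ≠ 0 → (α.1.1 : ℕ) < β.1.1 → (α.1.2 : ℕ) ≤ β.1.2 := by
    intro α β hα hβ hlt
    obtain ⟨a, rfl⟩ := hsupp α hα
    obtain ⟨b, rfl⟩ := hsupp β hβ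
    rcases le_total a b with hab | hab
    · exact hm2 hab
    · exact absurd (hm1 hab) (not_le.2 hlt)
  have hi0 : ∀ α, s' α ≠ 0 → (i : ℕ) ≤ α.1.1 := fun α hα => by
    obtain ⟨a, rfl⟩ := hsupp α hα
    rw [← hi.1]
    exact hm1 (Fin.zero_le a)
  -- The part of `s` off the path is only a monomial factor.
  suffices hst : HasStraightening f (idealI f m) s' by
    have := hst.add (s.filter fun α => ¬ α ∈ Set.range p)
    rwa [hs', Finsupp.filter_add_filter_not] at this
  by_cases hlong : IsLong (p (Fin.last k)) j ∧ ∑ l ∈ Finset.Ici i, m l < ∑ t, s (p t)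
  · exact hasStraightening_of_long hf hchain i hi0 (by rw [hdeg]; exact hlong.2)
  · have hsimple : IsSimple (p (Fin.last k)) j ∧ ∑ l ∈ Finset.Icc i j, m l < ∑ t, s (p t) := by
      by_contra hc
      have h1 : IsSimple (p (Fin.last k)) j →
          ∑ t, (s (p t) : ℝ) ≤ ∑ l ∈ Finset.Icc i j, (m l : ℝ) := fun hsj => by
        have := fun h' => hc ⟨hsj, h'⟩
        exact_mod_cast not_lt.1 this
      obtain ⟨h2, h3⟩ := h h1
      exact hlong ⟨h2, by exact_mod_cast h3⟩
    obtain ⟨hsj, hlt⟩ := hsimple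
    have hij : i ≤ j := by
      rw [Fin.le_def, ← hi.1, ← hsj.1]
      exact hm1 (Fin.zero_le (Fin.last k))
    by_cases hj : (j : ℕ) + 1 < n
    · refine hasStraightening_of_short hf hchain i j hij hj hi0 (fun α hα => ?_)
        (by rw [hdeg]; exact hlt)
      obtain ⟨a, rfl⟩ := hsupp α hα
      rw [← hsj.2]
      exact hm2 (Fin.le_last a)
    -- For the last index `j` the simple root `α_n` is itself long, and both bounds agree.
    · refine hasStraightening_of_long hf hchain i hi0 ?_
      rw [hdeg]
      have e : Finset.Ici i = Finset.Icc i j := by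
        ext l
        have := l.2
        simp only [Finset.mem_Ici, Finset.mem_Icc, Fin.le_def]
        omega
      rw [e]
      exact hlt

end StraighteningLaw

/-! ### The triangular decomposition -/

section Triangular

variable {n : ℕ}

/-- The diagonal part of a matrix in `sp_{2n}`. -/
def diagPart (X : Sp n) : Sp n :=
  ⟨Matrix.of fun a b => if a = b then X.1 a b else 0, by
    obtain ⟨h1, h2, h3⟩ := (mem_sp_iff X.1).1 X.2
    rw [mem_sp_iff]
    refine ⟨fun i j => ?_, fun i j => ?_, fun i j => ?_⟩
    · by_cases h : i = j
      · simp [h, h1 j j]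
      · simp [h, Ne.symm h]
    · simp
    · simp⟩

theorem diagPart_apply (X : Sp n) (a b : Fin n ⊕ Fin n) :
    (diagPart X).1 a b = if a = b then X.1 a b else 0 := rfl

theorem diagPart_mem (X : Sp n) : diagPart X ∈ cartan n := fun _ _ h => if_neg h

/-- The strictly upper triangular part of a matrix in `sp_{2n}`. -/
def plusPart (X : Sp n) : nPlus n :=
  ⟨X - projMinus n X - diagPart X, fun a b h => by
    change X.1 a b - (projMinus n X).1.1 a b - (diagPart X).1 a b = 0
    rw [projMinus_apply, diagPart_apply]
    rcases h.eq_or_lt with h | h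
    · rw [if_neg (by omega), if_pos (pos_injective h).symm]
      ring
    · rw [if_pos h, if_neg (fun e => by rw [e] at h; omega)]
      ring⟩

theorem triangular_decomposition (X : Sp n) :
    X = projMinus n X + (diagPart X + plusPart X) := by
  change X = projMinus n X + (diagPart X + (X - projMinus n X - diagPart X))
  abel

/-- The subspace `h ⊕ n⁺` of upper triangular matrices. -/
def IsUpper (X : Sp n) : Prop := projMinus n X = 0

theorem isUpper_sub_projMinus (X : Sp n) : IsUpper (X - (projMinus n X : Sp n)) := by
  unfold IsUpper
  ext a b
  rw [projMinus_apply]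
  change (if pos b < pos a then X.1 a b - (projMinus n X).1.1 a b else 0) = 0
  rw [projMinus_apply]
  split_ifs <;> simp

theorem isUpper_of_mem_nPlus {X : Sp n} (h : X ∈ nPlus n) : IsUpper X := by
  unfold IsUpper
  ext a b
  rw [projMinus_apply]
  split_ifs with hab
  · exact h a b hab.le
  · rfl

end Triangular

/-! ### Highest weight vectors -/

section HighestWeight

variable {n : ℕ} {V : Type*} [AddCommGroup V] [Module ℂ V] [LieRingModule (Sp n) V]

/-- `v` is a singular vector of weight `m_1 ω_1 + ... + m_n ω_n`. -/
structure IsSingular (m : Fin n → ℕ) (v : V) : Prop where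
  lie_nPlus : ∀ e ∈ nPlus n, ⁅e, v⁆ = 0
  lie_cartan : ∀ H ∈ cartan n, ⁅H, v⁆ = weight m H • v

theorem IsSingular.lie_upper {m : Fin n → ℕ} {v : V} (hv : IsSingular m v) {X : Sp n}
    (hX : IsUpper X) : ⁅X, v⁆ = weight m (diagPart X) • v := by
  conv_lhs => rw [triangular_decomposition X]
  have h0 : ((projMinus n X : nMinus n) : Sp n) = 0 := by rw [hX]; rfl
  rw [h0, zero_add, add_lie, hv.lie_cartan _ (diagPart_mem X), hv.lie_nPlus _ (plusPart X).2,
    add_zero]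

variable [LieModule ℂ (Sp n) V]

/-- The vector `x_1 ... x_l v`. -/
def actList (l : List (nMinus n)) (v : V) : V := l.foldr (fun x w => ⁅(x : Sp n), w⁆) v

theorem filt_eq_span (v : V) (s : ℕ) :
    filt n v s = Submodule.span ℂ {w | ∃ l : List (nMinus n), l.length ≤ s ∧ w = actList l v} := by
  have key : ∀ l : List (nMinus n), UniversalEnvelopingAlgebra.lift ℂ
      (LieModule.toEnd ℂ (nMinus n) V) (l.map (UniversalEnvelopingAlgebra.ι ℂ)).prod v =
      actList l v := fun l => by
    induction l with
    | nil => simp [actList]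
    | cons x l ih =>
      rw [List.map_cons, List.prod_cons, map_mul, Module.End.mul_apply, ih,
        UniversalEnvelopingAlgebra.lift_ι_apply]
      rfl
  rw [filt, uFilt, Submodule.map_span]
  congr 1
  ext w
  constructor
  · rintro ⟨u, ⟨l, hl, rfl⟩, rfl⟩
    exact ⟨l, hl, key l⟩
  · rintro ⟨l, hl, rfl⟩
    exact ⟨_, ⟨l, hl, rfl⟩, key l⟩

theorem actList_mem_filt (v : V) (l : List (nMinus n)) : actList l v ∈ filt n v l.length := by
  rw [filt_eq_span]
  exact Submodule.subset_span ⟨l, le_rfl, rfl⟩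

theorem filt_mono (v : V) {s t : ℕ} (h : s ≤ t) : filt n v s ≤ filt n v t := by
  rw [filt_eq_span, filt_eq_span]
  refine Submodule.span_mono ?_
  rintro w ⟨l, hl, rfl⟩
  exact ⟨l, hl.trans h, rfl⟩

/-- Move `X` to the right past each `x ∈ n⁻`. The commutator splits into a part in `n⁻`, which takes
the place of `x`, and an upper part, to which the induction applies; this is why the induction is
over all upper `X` at once. -/
theorem IsSingular.lie_upper_mem_filt {m : Fin n → ℕ} {v : V} (hv : IsSingular m v) {X : Sp n}
    (hX : IsUpper X) {s : ℕ} {w : V} (hw : w ∈ filt n v s) : ⁅X, w⁆ ∈ filt n v s := by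
  have key : ∀ (l : List (nMinus n)) (X : Sp n), IsUpper X →
      ⁅X, actList l v⁆ ∈ filt n v l.length := fun l => by
    induction l with
    | nil =>
      intro X hX
      change ⁅X, v⁆ ∈ _
      rw [hv.lie_upper hX]
      exact Submodule.smul_mem _ _ (mem_filt_zero v)
    | cons x l ih =>
      intro X hX
      change ⁅X, ⁅(x : Sp n), actList l v⁆⁆ ∈ filt n v (l.length + 1)
      have e : ⁅X, ⁅(x : Sp n), actList l v⁆⁆ = ⁅projMinus n ⁅X, (x : Sp n)⁆, actList l v⁆ +
          ⁅⁅X, (x : Sp n)⁆ - projMinus n ⁅X, (x : Sp n)⁆, actList l v⁆ +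
          ⁅x, ⁅X, actList l v⁆⁆ := by
        rw [leibniz_lie X (x : Sp n), sub_lie]
        change _ = ⁅((projMinus n ⁅X, (x : Sp n)⁆ : nMinus n) : Sp n), actList l v⁆ + _ +
          ⁅(x : Sp n), ⁅X, actList l v⁆⁆
        abel
      rw [e]
      refine add_mem (add_mem (lie_mem_filt v _ _ _ (actList_mem_filt v l))
        (filt_mono v (Nat.le_succ _) (ih _ (isUpper_sub_projMinus _)))) (lie_mem_filt v _ _ _ (ih X hX))
  rw [filt_eq_span] at hw
  induction hw using Submodule.span_induction with
  | mem w hw =>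
    obtain ⟨l, hl, rfl⟩ := hw
    exact filt_mono v hl (key l X hX)
  | zero => rw [lie_zero]; exact zero_mem _
  | add a b _ _ ha hb => rw [lie_add]; exact add_mem ha hb
  | smul c a _ ha => rw [lie_smul]; exact Submodule.smul_mem _ _ ha

theorem IsSingular.lie_upper_mem_filtPred {m : Fin n → ℕ} {v : V} (hv : IsSingular m v)
    {X : Sp n} (hX : IsUpper X) {s : ℕ} {w : V} (hw : w ∈ filtPred n v s) :
    ⁅X, w⁆ ∈ filtPred n v s := by
  cases s with
  | zero =>
    rw [(Submodule.mem_bot ℂ).1 hw, lie_zero]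
    exact zero_mem _
  | succ s => exact hv.lie_upper_mem_filt hX hw

/-! ### The action of `n⁺` on the associated graded space -/

/-- The operator on `V_s` given by `e ∈ n⁺`. -/
def upStep {m : Fin n → ℕ} {v : V} (hv : IsSingular m v) (e : nPlus n) (s : ℕ) :
    filt n v s →ₗ[ℂ] filt n v s :=
  (LieModule.toEnd ℂ (Sp n) V (e : Sp n)).restrict fun _ hw =>
    hv.lie_upper_mem_filt (isUpper_of_mem_nPlus e.2) hw

/-- The operator on `gr V` given by `e ∈ n⁺`. -/
def grUp {m : Fin n → ℕ} {v : V} (hv : IsSingular m v) (e : nPlus n) : Module.End ℂ (Gr n v) :=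
  DirectSum.toModule ℂ ℕ (Gr n v) fun s =>
    DirectSum.lof ℂ ℕ (GrPiece n v) s ∘ₗ
      Submodule.mapQ _ _ (upStep hv e s) fun _ hw =>
        hv.lie_upper_mem_filtPred (isUpper_of_mem_nPlus e.2) hw

theorem grUp_lof_mk {m : Fin n → ℕ} {v : V} (hv : IsSingular m v) (e : nPlus n) (s : ℕ)
    (w : filt n v s) :
    grUp hv e (DirectSum.lof ℂ ℕ (GrPiece n v) s (Submodule.Quotient.mk w)) =
      DirectSum.lof ℂ ℕ (GrPiece n v) s (Submodule.Quotient.mk (upStep hv e s w)) := by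
  rw [grUp, DirectSum.toModule_lof]
  rfl

/-- The part of `[e, x]` in `h ⊕ n⁺` preserves `V_s`, and so vanishes in `V_{s+1} / V_s`. Only the
projection to `n⁻` remains. -/
theorem grUp_mul_grOp {m : Fin n → ℕ} {v : V} (hv : IsSingular m v) (e : nPlus n)
    (x : nMinus n) :
    grUp hv e * grOp v x = grOp v (actMinus n e x) + grOp v x * grUp hv e :=
  gr_hom_ext fun s w => by
    rw [Module.End.mul_apply, LinearMap.add_apply, Module.End.mul_apply, grOp_lof_mk, grOp_lof_mk,
      grUp_lof_mk, grUp_lof_mk, grOp_lof_mk, ← map_add, ← Submodule.Quotient.mk_add]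
    congr 1
    rw [Submodule.Quotient.eq]
    change ⁅(e : Sp n), ⁅(x : Sp n), (w : V)⁆⁆ -
      (⁅((projMinus n ⁅(e : Sp n), (x : Sp n)⁆ : nMinus n) : Sp n), (w : V)⁆ +
        ⁅(x : Sp n), ⁅(e : Sp n), (w : V)⁆⁆) ∈ filt n v s
    have h := hv.lie_upper_mem_filt (isUpper_sub_projMinus ⁅(e : Sp n), (x : Sp n)⁆) w.2
    rw [sub_lie] at h
    convert h using 1
    rw [leibniz_lie (e : Sp n) (x : Sp n)]
    abel

theorem grUp_grTop {m : Fin n → ℕ} {v : V} (hv : IsSingular m v) (e : nPlus n) :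
    grUp hv e (grTop v) = 0 := by
  rw [grTop, grUp_lof_mk]
  have : upStep hv e 0 ⟨v, mem_filt_zero v⟩ = 0 := Subtype.ext (hv.lie_nPlus _ e.2)
  rw [this, Submodule.Quotient.mk_zero, map_zero]

theorem grUp_grAct {m : Fin n → ℕ} {v : V} (hv : IsSingular m v) (e : nPlus n)
    (p : SymMinus n) :
    grUp hv e * grAct v p = grAct v (actSym n e p) + grAct v p * grUp hv e := by
  change _ = grAct v (symDer (actMinus n e) p) + _
  induction p using SymmetricAlgebra.induction with
  | algebraMap r =>
    rw [Derivation.map_algebraMap, map_zero, zero_add, AlgHom.commutes]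
    exact (Algebra.commutes r _).symm
  | ι x => rw [symDer_ι, grAct_ι, grAct_ι, grUp_mul_grOp]
  | mul a b ha hb =>
    rw [Derivation.leibniz, smul_eq_mul, smul_eq_mul, mul_comm b, map_add, map_mul, map_mul,
      map_mul,
      ← mul_assoc, ha, add_mul, mul_assoc, hb, mul_add]
    simp only [mul_assoc]
    abel
  | add a b ha hb =>
    have e1 : grAct v (a + b) = grAct v a + grAct v b := map_add _ _ _
    have e2 : grAct v (symDer (actMinus n e) (a + b)) =
        grAct v (symDer (actMinus n e) a) + grAct v (symDer (actMinus n e) b) := by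
      rw [Derivation.map_add]
      exact map_add _ _ _
    rw [e1, e2, mul_add, ha, hb, add_mul]
    abel

/-! ### The annihilator of the highest weight vector and the spanning property. -/

theorem actU_mem_of_stable (S : Submodule ℂ (SymMinus n))
    (hS : ∀ (e : nPlus n), ∀ p ∈ S, actSym n e p ∈ S)
    (u : UniversalEnvelopingAlgebra ℂ (nPlus n)) {p : SymMinus n} (hp : p ∈ S) :
    actU n u p ∈ S := by
  let A : Subalgebra ℂ (Module.End ℂ (SymMinus n)) :=
    { carrier := {T | ∀ p ∈ S, T p ∈ S}
      mul_mem' := fun {T T'} h h' p hp => h _ (h' p hp)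
      add_mem' := fun {T T'} h h' p hp => add_mem (h p hp) (h' p hp)
      algebraMap_mem' := fun r p hp => S.smul_mem r hp }
  let g : nPlus n →ₗ⁅ℂ⁆ A :=
    { toFun := fun e => ⟨actSym n e, hS e⟩
      map_add' := fun e e' => Subtype.ext (map_add _ e e')
      map_smul' := fun c e => Subtype.ext (map_smul _ c e)
      map_lie' := fun {e e'} => Subtype.ext (LieHom.map_lie _ e e') }
  have h : A.val.comp (UniversalEnvelopingAlgebra.lift ℂ g) = actU n := by
    apply UniversalEnvelopingAlgebra.hom_ext
    ext1 e
    change ((UniversalEnvelopingAlgebra.lift ℂ g (UniversalEnvelopingAlgebra.ι ℂ e) : A) :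
      Module.End ℂ (SymMinus n)) =
      UniversalEnvelopingAlgebra.lift ℂ (actSym n) (UniversalEnvelopingAlgebra.ι ℂ e)
    rw [UniversalEnvelopingAlgebra.lift_ι_apply, UniversalEnvelopingAlgebra.lift_ι_apply]
    rfl
  rw [← h]
  exact (UniversalEnvelopingAlgebra.lift ℂ g u).2 p hp

/-- The ideal `I(λ)` annihilates the class of the highest weight vector, if its generators do. -/
theorem IsSingular.grAct_idealI {m : Fin n → ℕ} {v : V} (hv : IsSingular m v)
    {f : PosRoot n → nMinus n} (hR : ∀ r ∈ rootPowers f m, grAct v r (grTop v) = 0)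
    {q : SymMinus n} (hq : q ∈ idealI f m) : grAct v q (grTop v) = 0 := by
  let S : Submodule ℂ (SymMinus n) :=
    LinearMap.ker ((LinearMap.applyₗ (grTop v)) ∘ₗ (grAct v).toLinearMap)
  have hmem : ∀ p, p ∈ S ↔ grAct v p (grTop v) = 0 := fun p => Iff.rfl
  have hS : ∀ (e : nPlus n), ∀ p ∈ S, actSym n e p ∈ S := fun e p hp => by
    rw [hmem] at hp ⊢
    have h := LinearMap.congr_fun (grUp_grAct hv e p) (grTop v)
    rw [Module.End.mul_apply, LinearMap.add_apply, Module.End.mul_apply, hp, grUp_grTop, map_zero,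
      map_zero, add_zero] at h
    exact h.symm
  rw [idealI, ← Ideal.submodule_span_eq] at hq
  induction hq using Submodule.span_induction with
  | mem q hq =>
    obtain ⟨u, r, hr, rfl⟩ := hq
    have hrS : r ∈ S := (Submodule.span_le (p := S)).2 (fun r hr => hR r hr) hr
    exact actU_mem_of_stable S hS u hrS
  | zero => rw [map_zero, LinearMap.zero_apply]
  | add a b _ _ ha hb => rw [map_add, LinearMap.add_apply, ha, hb, add_zero]
  | smul c a _ ha => rw [smul_eq_mul, map_mul, Module.End.mul_apply, ha, map_zero]

/-- The action of a product of elements of `n⁻` on the class of the highest weight vector. -/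
theorem grAct_list_prod (v : V) (l : List (nMinus n)) :
    grAct v ((l.map (SymmetricAlgebra.ι ℂ (nMinus n))).prod) (grTop v) =
      DirectSum.lof ℂ ℕ (GrPiece n v) l.length
        (Submodule.Quotient.mk ⟨actList l v, actList_mem_filt v l⟩) := by
  induction l with
  | nil =>
    rw [List.map_nil, List.prod_nil, map_one, Module.End.one_apply]
    rfl
  | cons x l ih =>
    rw [List.map_cons, List.prod_cons, map_mul, Module.End.mul_apply, ih, grAct_ι, grOp_lof_mk]
    rfl

theorem exists_grAct (v : V) (y : Gr n v) : ∃ p, grAct v p (grTop v) = y := by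
  let S : Submodule ℂ (Gr n v) :=
    LinearMap.range ((LinearMap.applyₗ (grTop v)) ∘ₗ (grAct v).toLinearMap)
  have key : ∀ s (w : V) (hw : w ∈ filt n v s),
      DirectSum.lof ℂ ℕ (GrPiece n v) s (Submodule.Quotient.mk ⟨w, hw⟩) ∈ S := by
    intro s w hw
    have hw' := hw
    rw [filt_eq_span] at hw'
    induction hw' using Submodule.span_induction with
    | mem w hw' =>
      obtain ⟨l, hl, rfl⟩ := hw'
      rcases hl.eq_or_lt with rfl | hl
      · exact ⟨_, grAct_list_prod v l⟩
      -- A product with fewer than `s` factors already lies in `V_{s-1}`.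
      · have : (Submodule.Quotient.mk ⟨actList l v, hw⟩ : GrPiece n v s) = 0 := by
          rw [Submodule.Quotient.mk_eq_zero]
          obtain ⟨t, rfl⟩ : ∃ t, s = t + 1 := ⟨s - 1, by omega⟩
          exact filt_mono v (Nat.lt_succ_iff.1 hl) (actList_mem_filt v l)
        rw [this, map_zero]
        exact zero_mem _
    | zero =>
      have : (⟨0, hw⟩ : filt n v s) = 0 := rfl
      rw [this, Submodule.Quotient.mk_zero, map_zero]
      exact zero_mem _
    | add a b ha' hb' ha hb =>
      rw [← filt_eq_span] at ha' hb'
      have : (⟨a + b, hw⟩ : filt n v s) = ⟨a, ha'⟩ + ⟨b, hb'⟩ := rfl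
      rw [this, Submodule.Quotient.mk_add, map_add]
      exact add_mem (ha ha') (hb hb')
    | smul c a ha' ha =>
      rw [← filt_eq_span] at ha'
      have : (⟨c • a, hw⟩ : filt n v s) = c • ⟨a, ha'⟩ := rfl
      rw [this, Submodule.Quotient.mk_smul, map_smul]
      exact S.smul_mem _ (ha ha')
  have hy : y ∈ S := by
    induction y using DirectSum.induction_on with
    | zero => exact zero_mem _
    | of s x =>
      obtain ⟨w, rfl⟩ := Submodule.Quotient.mk_surjective _ x
      exact key s w.1 w.2
    | add a b ha hb => exact add_mem ha hb
  exact hy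

theorem mem_span_mon {f : PosRoot n → nMinus n} (hf : IsRootVectors f) (p : SymMinus n) :
    p ∈ Submodule.span ℂ (Set.range (mon f)) := by
  induction p using SymmetricAlgebra.induction with
  | algebraMap r =>
    rw [Algebra.algebraMap_eq_smul_one]
    exact Submodule.smul_mem _ _ (Submodule.subset_span ⟨0, Finsupp.prod_zero_index⟩)
  | ι x =>
    have h := Submodule.mem_map_of_mem (f := SymmetricAlgebra.ι ℂ (nMinus n))
      (mem_span_rootVectors hf x)
    rw [Submodule.map_span] at h
    refine Submodule.span_mono ?_ h
    rintro _ ⟨_, ⟨α, rfl⟩, rfl⟩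
    exact ⟨Finsupp.single α 1, by rw [mon, Finsupp.prod_single_index (by simp), pow_one]⟩
  | mul a b ha hb =>
    have h := Submodule.mul_mem_mul ha hb
    rw [Submodule.span_mul_span] at h
    refine Submodule.span_mono ?_ h
    rintro _ ⟨_, ⟨s, rfl⟩, _, ⟨t, rfl⟩, rfl⟩
    exact ⟨s + t, mon_add f s t⟩
  | add a b ha hb => exact add_mem ha hb

/-- The straightening law implies the spanning property. -/
theorem IsSingular.span_eq_top {m : Fin n → ℕ} {v : V} (hv : IsSingular m v)
    {f : PosRoot n → nMinus n} (hf : IsRootVectors f)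
    (hR : ∀ r ∈ rootPowers f m, grAct v r (grTop v) = 0) :
    Submodule.span ℂ {w : Gr n v | ∃ s ∈ latticePoints m, w = grAct v (mon f s) (grTop v)} = ⊤ := by
  rw [eq_top_iff]
  intro y _
  set W := Submodule.span ℂ
    {w : Gr n v | ∃ s ∈ latticePoints m, w = grAct v (mon f s) (grTop v)} with hW
  -- Well-founded induction along the monomial order: modulo the annihilator, a monomial outside
  -- `S(λ)` is a combination of smaller ones.
  have key : ∀ s : PosRoot n →₀ ℕ, grAct v (mon f s) (grTop v) ∈ W := by
    intro s
    induction h : (rootLex n).toSyn s using WellFoundedLT.induction generalizing s with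
    | ind a ih =>
      subst h
      by_cases hs : s ∈ latticePoints m
      · exact Submodule.subset_span ⟨s, hs, rfl⟩
      · obtain ⟨c, hc, hI⟩ := hasStraightening hf hs
        let L : SymMinus n →ₗ[ℂ] Gr n v := (LinearMap.applyₗ (grTop v)) ∘ₗ (grAct v).toLinearMap
        have h0 : L (mon f s - c.sum fun t a => a • mon f t) = 0 := hv.grAct_idealI hR hI
        rw [map_sub, sub_eq_zero] at h0
        change L (mon f s) ∈ W
        rw [h0, Finsupp.sum, map_sum]
        refine Submodule.sum_mem _ fun t ht => ?_
        rw [map_smul]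
        exact W.smul_mem _ (ih _ (hc t ht).1 t rfl)
  obtain ⟨p, rfl⟩ := exists_grAct v y
  have hp := mem_span_mon hf p
  induction hp using Submodule.span_induction with
  | mem p hp =>
    obtain ⟨s, rfl⟩ := hp
    exact key s
  | zero => rw [map_zero]; exact zero_mem _
  | add a b _ _ ha hb =>
    rw [map_add]
    exact add_mem (ha trivial) (hb trivial)
  | smul c a _ ha =>
    rw [map_smul]
    exact W.smul_mem _ (ha trivial)

end HighestWeight

/-! ### Comparison of modules generated by singular vectors -/

section Comparison

variable {n : ℕ}

/-- The submodule `U(n⁻) v`. -/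
def negSpan (n : ℕ) {V : Type*} [AddCommGroup V] [Module ℂ V] [LieRingModule (Sp n) V]
    [LieModule ℂ (Sp n) V] (v : V) : Submodule ℂ V :=
  Submodule.span ℂ {w | ∃ l : List (nMinus n), w = actList l v}

theorem IsSingular.lie_mem_negSpan {V : Type*} [AddCommGroup V] [Module ℂ V]
    [LieRingModule (Sp n) V] [LieModule ℂ (Sp n) V] {m : Fin n → ℕ} {v : V}
    (hv : IsSingular m v) (X : Sp n) {w : V} (hw : w ∈ negSpan n v) : ⁅X, w⁆ ∈ negSpan n v := by
  induction hw using Submodule.span_induction with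
  | mem w hw =>
    obtain ⟨l, rfl⟩ := hw
    have e : ⁅X, actList l v⁆ = ⁅((projMinus n X : nMinus n) : Sp n), actList l v⁆ +
        ⁅X - (projMinus n X : Sp n), actList l v⁆ := by rw [sub_lie]; abel
    rw [e]
    refine add_mem (Submodule.subset_span ⟨projMinus n X :: l, rfl⟩) ?_
    have h := hv.lie_upper_mem_filt (isUpper_sub_projMinus X) (actList_mem_filt v l)
    rw [filt_eq_span] at h
    refine Submodule.span_mono ?_ h
    rintro w ⟨l, -, rfl⟩
    exact ⟨l, rfl⟩
  | zero => rw [lie_zero]; exact zero_mem _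
  | add a b _ _ ha hb => rw [lie_add]; exact add_mem ha hb
  | smul c a _ ha => rw [lie_smul]; exact Submodule.smul_mem _ _ ha

/-- The diagonal matrix in `sp_{2n}` whose eigenvalue on `x_a` is `-pos a`. -/
def gradingElement (n : ℕ) : Sp n :=
  ⟨Matrix.of fun a b => if a = b then -(pos a : ℂ) else 0, by
    rw [mem_sp_iff]
    refine ⟨fun i j => ?_, fun i j => by simp, fun i j => by simp⟩
    by_cases h : i = j
    · simp [h, pos]
    · simp [h, Ne.symm h]⟩

theorem gradingElement_mem (n : ℕ) : gradingElement n ∈ cartan n := fun _ _ h => if_neg h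

theorem lie_gradingElement_negProd {a b : Fin n ⊕ Fin n} (h : 0 < pos a + pos b) :
    ⁅gradingElement n, (negProd a b : Sp n)⁆ =
      (-((pos a + pos b : ℤ) : ℂ)) • (negProd a b : Sp n) := by
  have h1 : ∀ c d, (gradingElement n).1 c d = if c = d then -(pos c : ℂ) else 0 :=
    fun c d => rfl
  rw [coe_negProd h, lie_symProd]
  simp only [h1, ite_smul, zero_smul, Finset.sum_ite_eq', Finset.mem_univ, if_true]
  rw [← add_smul]
  push_cast
  ring_nf

section

variable {V : Type*} [AddCommGroup V] [Module ℂ V] [LieRingModule (Sp n) V]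
  [LieModule ℂ (Sp n) V]

/-- The sum of the eigenspaces of the grading element for `μ - j`, `μ - j - 1`, .... -/
def lowerSum (V : Type*) [AddCommGroup V] [Module ℂ V] [LieRingModule (Sp n) V]
    [LieModule ℂ (Sp n) V] (μ : ℂ) (j : ℕ) : Submodule ℂ V :=
  ⨆ k : ℕ, (LieModule.toEnd ℂ (Sp n) V (gradingElement n)).eigenspace (μ - (k + j : ℕ))

theorem lowerSum_succ_le (μ : ℂ) (j : ℕ) :
    lowerSum (n := n) V μ (j + 1) ≤ lowerSum (n := n) V μ j := by
  refine iSup_le fun k => ?_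
  refine le_trans (le_of_eq ?_) (le_iSup _ (k + 1))
  congr 3
  ring

theorem lie_mem_lowerSum {μ : ℂ} {w : V} (hw : w ∈ lowerSum (n := n) V μ 0) (x : nMinus n) :
    ⁅(x : Sp n), w⁆ ∈ lowerSum (n := n) V μ 1 := by
  have key : ∀ (a b : Fin n ⊕ Fin n), ∀ w ∈ lowerSum (n := n) V μ 0,
      ⁅(negProd a b : Sp n), w⁆ ∈ lowerSum (n := n) V μ 1 := by
    intro a b w hw
    by_cases h : 0 < pos a + pos b
    · unfold lowerSum at hw
      induction hw using Submodule.iSup_induction' with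
      | mem k w hk =>
        rw [Module.End.mem_eigenspace_iff] at hk
        change ⁅gradingElement n, w⁆ = _ at hk
        obtain ⟨d, hd⟩ : ∃ d : ℕ, pos a + pos b = d + 1 :=
          ⟨(pos a + pos b - 1).toNat, by omega⟩
        refine Submodule.mem_iSup_of_mem (k + d) ?_
        rw [Module.End.mem_eigenspace_iff]
        change ⁅gradingElement n, ⁅(negProd a b : Sp n), w⁆⁆ = _
        rw [leibniz_lie, lie_gradingElement_negProd h, hk, smul_lie, lie_smul, ← add_smul, hd]
        congr 1
        push_cast
        ring
      | zero => rw [lie_zero]; exact zero_mem _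
      | add a b _ _ ha hb => rw [lie_add]; exact add_mem ha hb
    · rw [negProd_eq_zero (not_lt.1 h)]
      change ⁅(0 : Sp n), w⁆ ∈ _
      rw [zero_lie]
      exact zero_mem _
  have hx : (x : Sp n) = ∑ a, ∑ b, (2⁻¹ * (sgn b * x.1.1 a b.swap)) • (negProd a b : Sp n) := by
    have := congrArg (fun y : nMinus n => (y : Sp n)) (nMinus_eq_sum x)
    simpa using this
  rw [hx]
  simp only [sum_lie, smul_lie]
  exact sum_mem fun a _ => sum_mem fun b _ => Submodule.smul_mem _ _ (key a b w hw)

theorem IsSingular.actList_mem_lowerSum {m : Fin n → ℕ} {v : V} (hv : IsSingular m v)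
    (l : List (nMinus n)) :
    actList l v ∈ lowerSum (n := n) V (weight m (gradingElement n)) 0 := by
  induction l with
  | nil =>
    refine Submodule.mem_iSup_of_mem 0 ?_
    rw [Module.End.mem_eigenspace_iff]
    change ⁅gradingElement n, v⁆ = _
    rw [hv.lie_cartan _ (gradingElement_mem n)]
    simp [actList]
  | cons x l ih => exact lowerSum_succ_le _ _ (lie_mem_lowerSum ih x)

/-- Eigenspaces of the grading element for distinct eigenvalues are independent. No
finite-dimensionality is needed. -/
theorem IsSingular.eq_zero_of_mem_lowerSum {m : Fin n → ℕ} {v : V} (hv : IsSingular m v)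
    (h : v ∈ lowerSum (n := n) V (weight m (gradingElement n)) 1) : v = 0 := by
  set μ := weight m (gradingElement n)
  set T := LieModule.toEnd ℂ (Sp n) V (gradingElement n)
  have h1 : v ∈ T.eigenspace μ :=
    Module.End.mem_eigenspace_iff.2 (hv.lie_cartan _ (gradingElement_mem n))
  have h2 : lowerSum (n := n) V μ 1 ≤ ⨆ ν, ⨆ (_ : ν ≠ μ), T.eigenspace ν := by
    refine iSup_le fun k => le_iSup₂_of_le (μ - (k + 1 : ℕ)) ?_ le_rfl
    intro hc
    rw [sub_eq_self] at hc
    exact Nat.cast_ne_zero.2 (Nat.succ_ne_zero k) hc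
  exact (Submodule.disjoint_def.1 (T.eigenspaces_iSupIndep μ)) v h1 (h2 h)

end

/-- The componentwise action on a product. -/
instance prodLieRingModule {V T : Type*} [AddCommGroup V] [LieRingModule (Sp n) V]
    [AddCommGroup T] [LieRingModule (Sp n) T] : LieRingModule (Sp n) (V × T) where
  bracket X p := (⁅X, p.1⁆, ⁅X, p.2⁆)
  add_lie X Y p := Prod.ext (add_lie X Y p.1) (add_lie X Y p.2)
  lie_add X p q := Prod.ext (lie_add X p.1 q.1) (lie_add X p.2 q.2)
  leibniz_lie X Y p := Prod.ext (leibniz_lie X Y p.1) (leibniz_lie X Y p.2)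

instance prodLieModule {V T : Type*} [AddCommGroup V] [Module ℂ V] [LieRingModule (Sp n) V]
    [LieModule ℂ (Sp n) V] [AddCommGroup T] [Module ℂ T] [LieRingModule (Sp n) T]
    [LieModule ℂ (Sp n) T] : LieModule ℂ (Sp n) (V × T) where
  smul_lie c X p := Prod.ext (smul_lie c X p.1) (smul_lie c X p.2)
  lie_smul c X p := Prod.ext (lie_smul c X p.1) (lie_smul c X p.2)

theorem actList_prod {V T : Type*} [AddCommGroup V] [Module ℂ V] [LieRingModule (Sp n) V]
    [LieModule ℂ (Sp n) V] [AddCommGroup T] [Module ℂ T] [LieRingModule (Sp n) T]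
    [LieModule ℂ (Sp n) T] (l : List (nMinus n)) (v : V) (w : T) :
    actList l (v, w) = (actList l v, actList l w) := by
  induction l with
  | nil => rfl
  | cons x l ih =>
    change ⁅(x : Sp n), actList l (v, w)⁆ = _
    rw [ih]
    rfl

/-- A relation which holds for some nonzero singular vector holds for the highest weight vector of
the irreducible module of the same highest weight. -/
theorem IsIrreducibleHighestWeight.actList_eq_zero {V T : Type*} [AddCommGroup V] [Module ℂ V]
    [LieRingModule (Sp n) V] [LieModule ℂ (Sp n) V] [AddCommGroup T] [Module ℂ T]
    [LieRingModule (Sp n) T] [LieModule ℂ (Sp n) T] {m : Fin n → ℕ} {v : V} {w : T}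
    (hv : IsIrreducibleHighestWeight m v) (hw : IsSingular m w) (hw0 : w ≠ 0)
    {l : List (nMinus n)} (hl : actList l w = 0) : actList l v = 0 := by
  have hvs : IsSingular m v := ⟨hv.lie_nPlus, hv.lie_cartan⟩
  have hvw : IsSingular m (v, w) :=
    ⟨fun e he => Prod.ext (hv.lie_nPlus e he) (hw.lie_nPlus e he),
      fun H hH => Prod.ext (hv.lie_cartan H hH) (hw.lie_cartan H hH)⟩
  -- The same scalar serves both components: every nonempty product of elements of `n⁻` lowers the
  -- eigenvalue of the grading element, so only the empty product contributes a multiple of `(v,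
  -- w)`.
  have hdecomp : ∀ p ∈ negSpan n (v, w), ∃ c : ℂ,
      p.1 - c • v ∈ lowerSum (n := n) V (weight m (gradingElement n)) 1 ∧
      p.2 - c • w ∈ lowerSum (n := n) T (weight m (gradingElement n)) 1 := by
    intro p hp
    induction hp using Submodule.span_induction with
    | mem p hp =>
      obtain ⟨l, rfl⟩ := hp
      rw [actList_prod]
      cases l with
      | nil => exact ⟨1, by simp [actList], by simp [actList]⟩
      | cons x l =>
        refine ⟨0, ?_, ?_⟩
        · rw [zero_smul, sub_zero]
          exact lie_mem_lowerSum (hvs.actList_mem_lowerSum l) x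
        · rw [zero_smul, sub_zero]
          exact lie_mem_lowerSum (hw.actList_mem_lowerSum l) x
    | zero => exact ⟨0, by simp, by simp⟩
    | add p q _ _ hp hq =>
      obtain ⟨c, h1, h2⟩ := hp
      obtain ⟨d, h3, h4⟩ := hq
      refine ⟨c + d, ?_, ?_⟩
      · have := add_mem h1 h3
        rw [add_smul]
        convert this using 1
        rw [Prod.fst_add]
        abel
      · have := add_mem h2 h4
        rw [add_smul]
        convert this using 1
        rw [Prod.snd_add]
        abel
    | smul a p _ hp =>
      obtain ⟨c, h1, h2⟩ := hp
      refine ⟨a * c, ?_, ?_⟩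
      · have := Submodule.smul_mem _ a h1
        rwa [smul_sub, smul_smul] at this
      · have := Submodule.smul_mem _ a h2
        rwa [smul_sub, smul_smul] at this
  -- `K` is the kernel of the projection to `T` from the submodule generated by `(v, w)`. It
  -- measures the failure of `w ↦ v` to define a homomorphism.
  let K : LieSubmodule ℂ (Sp n) V :=
    { toSubmodule := (negSpan n (v, w)).comap (LinearMap.inl ℂ V T)
      lie_mem := fun {X x} hx => by
        have := hvw.lie_mem_negSpan X (w := (x, 0)) hx
        change (⁅X, x⁆, (0 : T)) ∈ negSpan n (v, w)
        have e : ⁅X, ((x, 0) : V × T)⁆ = (⁅X, x⁆, 0) := Prod.ext rfl (lie_zero X)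
        rwa [e] at this }
  have hK : ∀ x, x ∈ K ↔ ((x, 0) : V × T) ∈ negSpan n (v, w) := fun x => Iff.rfl
  -- If `(v, 0)` were in the submodule, its second component would force the scalar to be zero, and
  -- then `v` would be a sum of vectors of lower eigenvalue.
  have hvK : v ∉ K := fun hmem => by
    obtain ⟨c, h1, h2⟩ := hdecomp _ ((hK v).1 hmem)
    simp only [zero_sub] at h1 h2
    by_cases hc : c = 0
    · rw [hc, zero_smul, sub_zero] at h1
      exact hv.ne_zero (hvs.eq_zero_of_mem_lowerSum h1)
    · have h3 := Submodule.smul_mem _ c⁻¹ (neg_mem h2)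
      rw [neg_neg, smul_smul, inv_mul_cancel₀ hc, one_smul] at h3
      exact hw0 (hw.eq_zero_of_mem_lowerSum h3)
  have hbot : K = ⊥ := by
    have := hv.irreducible
    refine (eq_bot_or_eq_top K).resolve_right fun ht => hvK ?_
    rw [ht]
    exact LieSubmodule.mem_top v
  have hmem : actList l v ∈ K := by
    rw [hK, ← hl, ← actList_prod]
    exact Submodule.subset_span ⟨l, rfl⟩
  rw [hbot] at hmem
  exact (LieSubmodule.mem_bot _).1 hmem

end Comparison

/-! ### Derivations of products and determinants -/

section Derivations

variable {A : Type*} [CommRing A] [Algebra ℂ A] (D : Derivation ℂ A A)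

theorem derivation_prod {ι : Type*} [DecidableEq ι] (s : Finset ι) (g : ι → A) :
    D (∏ i ∈ s, g i) = ∑ i ∈ s, ∏ j ∈ s, Function.update g i (D (g i)) j := by
  induction s using Finset.induction_on with
  | empty => simp
  | insert a s ha ih =>
    rw [Finset.prod_insert ha, Derivation.leibniz, ih, Finset.sum_insert ha,
      Finset.prod_insert ha, Function.update_self, add_comm, smul_eq_mul, smul_eq_mul, mul_comm,
      Finset.mul_sum]
    congr 1
    · congr 1
      refine Finset.prod_congr rfl fun j hj => ?_
      rw [Function.update_of_ne]
      rintro rfl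
      exact ha hj
    · refine Finset.sum_congr rfl fun i hi => ?_
      rw [Finset.prod_insert ha, Function.update_of_ne]
      rintro rfl
      exact ha hi

theorem derivation_det {ι : Type*} [Fintype ι] [DecidableEq ι] (M : Matrix ι ι A) :
    D M.det = ∑ i, (M.updateCol i fun c => D (M c i)).det := by
  simp only [Matrix.det_apply]
  rw [map_sum, Finset.sum_comm]
  refine Finset.sum_congr rfl fun σ _ => ?_
  rw [← Finset.smul_sum]
  have hs : ∀ (u : ℤˣ) (x : A), D (u • x) = u • D x := fun u x => by
    rw [Units.smul_def, Units.smul_def, map_zsmul]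
  rw [hs, derivation_prod]
  congr 1
  refine Finset.sum_congr rfl fun i _ => Finset.prod_congr rfl fun j _ => ?_
  rw [Matrix.updateCol_apply, Function.update_apply]
  split_ifs with h <;> simp [h]

theorem derivation_iterate_zero (N : ℕ) : (D^[N]) 0 = 0 := by
  induction N with
  | zero => rfl
  | succ N ih => rw [Function.iterate_succ_apply, map_zero, ih]

theorem derivation_iterate_add (N : ℕ) (x y : A) : (D^[N]) (x + y) = (D^[N]) x + (D^[N]) y := by
  induction N generalizing x y with
  | zero => rfl
  | succ N ih => rw [Function.iterate_succ_apply, map_add, ih, Function.iterate_succ_apply,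
      Function.iterate_succ_apply]

/-- By Leibniz, each term of `D^{a+b+1}(xy)` puts more than `a` derivatives on `x` or more than `b`
on `y`. Splitting off one derivative at a time replaces the binomial expansion. -/
theorem derivation_iterate_mul {a b : ℕ} {x y : A} (hx : (D^[a + 1]) x = 0)
    (hy : (D^[b + 1]) y = 0) : (D^[a + b + 1]) (x * y) = 0 := by
  induction h : a + b generalizing a b x y with
  | zero =>
    obtain ⟨rfl, rfl⟩ : a = 0 ∧ b = 0 := by omega
    have hx' : D x = 0 := hx
    have hy' : D y = 0 := hy
    change D (x * y) = 0
    rw [Derivation.leibniz, hx', hy', smul_zero, smul_zero, add_zero]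
  | succ N ih =>
    rw [Function.iterate_succ_apply, Derivation.leibniz, derivation_iterate_add]
    have h1 : (D^[N + 1]) (x • D y) = 0 := by
      rcases b with _ | b
      · have hy' : D y = 0 := hy
        rw [hy', smul_zero, derivation_iterate_zero]
      · exact ih hx hy (by omega)
    have h2 : (D^[N + 1]) (y • D x) = 0 := by
      rcases a with _ | a
      · have hx' : D x = 0 := hx
        rw [hx', smul_zero, derivation_iterate_zero]
      · exact ih hy hx (by omega)
    rw [h1, h2, add_zero]

theorem derivation_iterate_pow {a : ℕ} {x : A} (hx : (D^[a + 1]) x = 0) (k : ℕ) :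
    (D^[k * a + 1]) (x ^ k) = 0 := by
  induction k with
  | zero => simp
  | succ k ih =>
    rw [pow_succ, Nat.succ_mul]
    exact derivation_iterate_mul D ih hx

theorem derivation_iterate_prod {ι : Type*} (s : Finset ι) (a : ι → ℕ) (g : ι → A)
    (h : ∀ i ∈ s, (D^[a i + 1]) (g i) = 0) : (D^[∑ i ∈ s, a i + 1]) (∏ i ∈ s, g i) = 0 := by
  classical
  induction s using Finset.induction_on with
  | empty => simp
  | insert i s hi ih =>
    rw [Finset.prod_insert hi, Finset.sum_insert hi]
    exact derivation_iterate_mul D (h i (Finset.mem_insert_self i s))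
      (ih fun j hj => h j (Finset.mem_insert_of_mem hj))

theorem derivation_prod_pow_eigen {ι : Type*} (s : Finset ι) (k : ι → ℕ) (c : ι → ℂ) (g : ι → A)
    (h : ∀ i, D (g i) = c i • g i) :
    D (∏ i ∈ s, g i ^ k i) = (∑ i ∈ s, k i * c i) • ∏ i ∈ s, g i ^ k i := by
  classical
  have hp : ∀ i, D (g i ^ k i) = (k i * c i) • g i ^ k i := fun i => by
    rw [Derivation.leibniz_pow, h]
    rcases hk : k i with _ | l
    · simp
    · rw [Nat.add_sub_cancel, ← Nat.cast_smul_eq_nsmul ℂ, smul_eq_mul, mul_smul_comm, smul_smul,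
        ← pow_succ]
  induction s using Finset.induction_on with
  | empty => simp
  | insert i s hi ih =>
    rw [Finset.prod_insert hi, Finset.sum_insert hi, Derivation.leibniz, ih, hp, smul_eq_mul,
      smul_eq_mul, mul_smul_comm, mul_smul_comm, add_smul, add_comm, mul_comm (∏ i ∈ s, _)]

end Derivations

/-! ### The polynomial module -/

section PolynomialModule

open MvPolynomial

variable {n : ℕ}

/-- The polynomials in the entries of a `2n × n` matrix. -/
abbrev MatPoly (n : ℕ) : Type := MvPolynomial ((Fin n ⊕ Fin n) × Fin n) ℂ

/-- The action of `sp_{2n}` on the polynomials through the columns of the matrix. -/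
def matDer (X : Sp n) : Derivation ℂ (MatPoly n) (MatPoly n) :=
  mkDerivation ℂ fun p => ∑ a, C (X.1 a p.1) * MvPolynomial.X (a, p.2)

theorem matDer_X (Y : Sp n) (b : Fin n ⊕ Fin n) (c : Fin n) :
    matDer Y (X (b, c)) = ∑ a, C (Y.1 a b) * X (a, c) := by
  rw [matDer, mkDerivation_X]

theorem matDer_linear (Y : Sp n) (g : Fin n ⊕ Fin n → ℂ) (c : Fin n) :
    matDer Y (∑ b, C (g b) * X (b, c)) = ∑ a, C (∑ b, Y.1 a b * g b) * X (a, c) := by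
  have h : ∀ b, matDer Y (C (g b) * X (b, c)) = ∑ a, C (Y.1 a b * g b) * X (a, c) := fun b => by
    rw [Derivation.leibniz, derivation_C, smul_zero, add_zero, smul_eq_mul, matDer_X,
      Finset.mul_sum]
    refine Finset.sum_congr rfl fun a _ => ?_
    rw [C_mul]
    ring
  rw [map_sum, Finset.sum_congr rfl fun b _ => h b, Finset.sum_comm]
  refine Finset.sum_congr rfl fun a _ => ?_
  rw [map_sum, Finset.sum_mul]

/-- The representation of `sp_{2n}` on the polynomials. -/
def matRep (n : ℕ) : Sp n →ₗ⁅ℂ⁆ Module.End ℂ (MatPoly n) where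
  toFun X := (matDer X).toLinearMap
  map_add' Y Z := by
    rw [← Derivation.coe_add_linearMap]
    congr 1
    refine MvPolynomial.derivation_ext fun ⟨b, c⟩ => ?_
    rw [Derivation.add_apply, matDer_X, matDer_X, matDer_X, ← Finset.sum_add_distrib]
    refine Finset.sum_congr rfl fun a _ => ?_
    rw [← add_mul, ← C_add]
    rfl
  map_smul' r Y := by
    rw [RingHom.id_apply, ← Derivation.coe_smul_linearMap]
    congr 1
    refine MvPolynomial.derivation_ext fun ⟨b, c⟩ => ?_
    rw [Derivation.smul_apply, matDer_X, matDer_X, Finset.smul_sum]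
    refine Finset.sum_congr rfl fun a _ => ?_
    rw [smul_eq_C_mul, ← mul_assoc, ← C_mul]
    rfl
  map_lie' := fun {Y Z} => by
    have h : matDer ⁅Y, Z⁆ = ⁅matDer Y, matDer Z⁆ := by
      refine MvPolynomial.derivation_ext fun ⟨b, c⟩ => ?_
      rw [Derivation.commutator_apply, matDer_X, matDer_X, matDer_X, matDer_linear, matDer_linear,
        ← Finset.sum_sub_distrib]
      refine Finset.sum_congr rfl fun a _ => ?_
      rw [← sub_mul, ← C_sub, lie_apply]
    rw [h]
    rfl

/-! ### Leading minors as singular vectors. -/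

/-- The matrix of the leading minor of size `k + 1`. -/
def minorMat (k : Fin n) : Matrix (Finset.Iic k) (Finset.Iic k) (MatPoly n) :=
  Matrix.of fun c i => X (Sum.inl i.1, c.1)

/-- The leading minor of size `k + 1`, a singular vector of weight `ω_{k+1}`. -/
def minor (k : Fin n) : MatPoly n := (minorMat k).det

/-- Evaluate at the matrix whose upper block is the identity. -/
theorem minor_ne_zero (k : Fin n) : minor k ≠ 0 := by
  intro h
  have h1 := congrArg (MvPolynomial.eval fun p : (Fin n ⊕ Fin n) × Fin n =>
    if p.1 = Sum.inl p.2 then (1 : ℂ) else 0) h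
  rw [minor, RingHom.map_det, map_zero] at h1
  have h2 : (MvPolynomial.eval fun p : (Fin n ⊕ Fin n) × Fin n =>
      if p.1 = Sum.inl p.2 then (1 : ℂ) else 0).mapMatrix (minorMat k) = 1 := by
    ext c i
    rw [RingHom.mapMatrix_apply, Matrix.map_apply, minorMat, Matrix.of_apply, eval_X,
      Matrix.one_apply]
    simp only [Sum.inl.injEq, Subtype.ext_iff, @eq_comm _ i.1]
  rw [h2, Matrix.det_one] at h1
  exact one_ne_zero h1

/-- An upper `Y` sends the column of `x_i` to a combination of columns `x_j` with `j ≤ i`, all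
within the minor. By alternation only the multiple of `x_i` itself survives, so the eigenvalue is a
partial trace. -/
theorem matDer_minor_of_upper {Y : Sp n} (hY : IsUpper Y) (k : Fin n) :
    matDer Y (minor k) = fundWeight k Y • minor k := by
  rw [minor, derivation_det, fundWeight, LinearMap.sum_apply, Finset.sum_smul,
    ← Finset.sum_coe_sort (Finset.Iic k)]
  refine Finset.sum_congr rfl fun i _ => ?_
  have hle : ∀ a : Fin n ⊕ Fin n, Y.1 a (Sum.inl i.1) ≠ 0 → ∃ j : Finset.Iic k, a = Sum.inl j.1 := by
    intro a ha
    have h1 : ¬ pos (Sum.inl i.1) < pos a := fun hlt => ha (by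
      have := congrArg (fun Z : nMinus n => Z.1.1 a (Sum.inl i.1)) hY
      rw [projMinus_apply, if_pos hlt] at this
      exact this)
    have hi := Finset.mem_Iic.1 i.2
    obtain (j | j) := a
    · refine ⟨⟨j, Finset.mem_Iic.2 (le_trans ?_ hi)⟩, rfl⟩
      rw [Fin.le_def]
      simp only [pos] at h1
      omega
    · exfalso
      simp only [pos] at h1
      have := j.2; have := i.1.2
      omega
  have hcol : (fun c : Finset.Iic k => matDer Y (minorMat k c i)) =
      fun c => ∑ j : Finset.Iic k, (C (Y.1 (Sum.inl j.1) (Sum.inl i.1)) : MatPoly n) • minorMat k c j := by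
    funext c
    change matDer Y (X (Sum.inl i.1, c.1)) = _
    rw [matDer_X]
    symm
    refine Finset.sum_of_injOn (fun j : Finset.Iic k => Sum.inl j.1) (fun a _ b _ h => by
      exact Subtype.ext (Sum.inl.inj h)) (fun _ _ => Finset.mem_coe.2 (Finset.mem_univ _))
      (fun a _ ha => ?_) fun j _ => rfl
    have : Y.1 a (Sum.inl i.1) = 0 := by
      by_contra hc
      obtain ⟨j, rfl⟩ := hle a hc
      exact ha ⟨j, Finset.mem_coe.2 (Finset.mem_univ j), rfl⟩
    rw [this, C_0, zero_mul]
  rw [hcol, Matrix.det_updateCol_sum, smul_eq_mul, ← smul_eq_C_mul]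
  rfl

/-- The product of minors, a singular vector of weight `m_1 ω_1 + ... + m_n ω_n`. -/
def minorProd (m : Fin n → ℕ) : MatPoly n := ∏ k, minor k ^ m k

theorem minorProd_ne_zero (m : Fin n → ℕ) : minorProd m ≠ 0 :=
  Finset.prod_ne_zero_iff.2 fun k _ => pow_ne_zero _ (minor_ne_zero k)

theorem matDer_minorProd_of_upper {Y : Sp n} (hY : IsUpper Y) (m : Fin n → ℕ) :
    matDer Y (minorProd m) = weight m Y • minorProd m := by
  rw [minorProd, derivation_prod_pow_eigen _ _ _ (fun k => fundWeight k Y) _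
    (matDer_minor_of_upper hY), weight, LinearMap.sum_apply]
  congr 1
  refine Finset.sum_congr rfl fun k _ => ?_
  rw [LinearMap.smul_apply, nsmul_eq_mul]

theorem isUpper_of_mem_cartan {H : Sp n} (h : H ∈ cartan n) : IsUpper H := by
  unfold IsUpper
  ext a b
  rw [projMinus_apply]
  split_ifs with hab
  · exact h a b fun e => by rw [e] at hab; omega
  · rfl

theorem weight_eq_zero_of_mem_nPlus {Y : Sp n} (h : Y ∈ nPlus n) (m : Fin n → ℕ) :
    weight m Y = 0 := by
  have h1 : ∀ l, eps l Y = 0 := fun l => h _ _ le_rfl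
  simp [weight, fundWeight, LinearMap.sum_apply, h1]

/-! ### Nilpotency of root vectors on products of minors. -/

/-- A matrix unit action `x_i ↦ r x_a` acts by a square zero operator on a minor, and by zero
unless the minor involves `x_i` but not `x_a`. -/
theorem matDer_minor_of_single {Y : Sp n} {i : Fin n} {a : Fin n ⊕ Fin n} {r : ℂ}
    (h : ∀ j b, Y.1 b (Sum.inl j) = if j = i then if b = a then r else 0 else 0)
    (ha : ∀ b, Y.1 b a = 0) (k : Fin n) :
    matDer Y (matDer Y (minor k)) = 0 ∧ (k < i → matDer Y (minor k) = 0) ∧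
      (∀ j, a = Sum.inl j → j ≠ i → j ≤ k → matDer Y (minor k) = 0) := by
  have hX : ∀ (j c : Fin n), matDer Y (X (Sum.inl j, c)) = if j = i then C r * X (a, c) else 0 := by
    intro j c
    rw [matDer_X]
    split_ifs with hj
    · rw [Finset.sum_eq_single a]
      · rw [h, if_pos hj, if_pos rfl]
      · intro b _ hb
        rw [h, if_pos hj, if_neg hb, C_0, zero_mul]
      · simp
    · refine Finset.sum_eq_zero fun b _ => ?_
      rw [h, if_neg hj, C_0, zero_mul]
  have hXa : ∀ c : Fin n, matDer Y (X (a, c)) = 0 := fun c => by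
    rw [matDer_X]
    refine Finset.sum_eq_zero fun b _ => ?_
    rw [ha, C_0, zero_mul]
  have hzero : ∀ (M : Matrix (Finset.Iic k) (Finset.Iic k) (MatPoly n)) (j : Finset.Iic k),
      (∀ c, M c j = 0) → M.det = 0 := fun M j hM => Matrix.det_eq_zero_of_column_eq_zero j hM
  have hterm : ∀ j : Finset.Iic k, j.1 ≠ i →
      ((minorMat k).updateCol j fun c => matDer Y (minorMat k c j)).det = 0 := fun j hj =>
    hzero _ j fun c => by
      rw [Matrix.updateCol_self]
      exact (hX _ _).trans (if_neg hj)
  by_cases hik : i ≤ k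
  · set i' : Finset.Iic k := ⟨i, Finset.mem_Iic.2 hik⟩ with hi'
    have h1 : matDer Y (minor k) =
        ((minorMat k).updateCol i' fun c => matDer Y (minorMat k c i')).det := by
      rw [minor, derivation_det]
      refine Finset.sum_eq_single i' (fun j _ hj => hterm j fun e => hj (Subtype.ext e)) (by simp)
    have hcol : ∀ c : Finset.Iic k, matDer Y (minorMat k c i') = C r * X (a, c.1) := fun c =>
      (hX _ _).trans (if_pos rfl)
    refine ⟨?_, fun hlt => absurd hik (not_le.2 hlt), fun j hja hji hjk => ?_⟩
    · rw [h1, derivation_det]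
      -- After the first application the column of `x_i` has become a multiple of `x_a`, which `Y`
      -- kills; `Y` kills the other columns too, so each summand has a zero column.
      refine Finset.sum_eq_zero fun j _ => hzero _ j fun c => ?_
      rw [Matrix.updateCol_self]
      by_cases hj : j = i'
      · rw [hj, Matrix.updateCol_self, hcol, Derivation.leibniz, hXa, derivation_C, smul_zero,
          smul_zero, add_zero]
      · rw [Matrix.updateCol_ne hj]
        exact (hX _ _).trans (if_neg fun e => hj (Subtype.ext e))
    · rw [h1]
      -- If `x_a` already belongs to the minor, the replacement creates two proportional columns.
      have e : (fun c => matDer Y (minorMat k c i')) =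
          (C r : MatPoly n) • fun c => minorMat k c ⟨j, Finset.mem_Iic.2 hjk⟩ := by
        funext c
        rw [hcol, hja]
        rfl
      rw [e, Matrix.det_updateCol_smul, Matrix.det_updateCol_eq_zero, mul_zero]
      exact fun e => hji (congrArg Subtype.val e)
  · have h0 : matDer Y (minor k) = 0 := by
      rw [minor, derivation_det]
      refine Finset.sum_eq_zero fun j _ => hterm j fun e => hik ?_
      rw [← e]
      exact Finset.mem_Iic.1 j.2
    rw [h0, map_zero]
    exact ⟨rfl, fun _ => rfl, fun _ _ _ _ => rfl⟩

/-- Nilpotency orders add over the product: each factor `minor k` with `k ∈ S` counts once, and the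
others, killed at once, count zero. -/
theorem matDer_iterate_minorProd {Y : Sp n} (S : Finset (Fin n)) (m : Fin n → ℕ)
    (h2 : ∀ k, matDer Y (matDer Y (minor k)) = 0) (h1 : ∀ k ∉ S, matDer Y (minor k) = 0) :
    ((matDer Y)^[∑ k ∈ S, m k + 1]) (minorProd m) = 0 := by
  classical
  have h := derivation_iterate_prod (matDer Y) Finset.univ (fun k => m k * if k ∈ S then 1 else 0)
    (fun k => minor k ^ m k) fun k _ => derivation_iterate_pow _ (by
      split_ifs with hk
      · exact h2 k
      · exact h1 k hk) _
  simp only [mul_ite, mul_one, mul_zero] at h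
  rwa [Finset.sum_ite_mem, Finset.univ_inter] at h

theorem vec_apply (α : PosRoot n) (b c : Fin n ⊕ Fin n) : α.vec.1.1 b c =
    (if b = α.fst then if c = Sum.inl α.1.1 then -1 else 0 else 0) +
    (if b = Sum.inr α.1.1 then if c = α.fst.swap then sgn α.fst else 0 else 0) := by
  have h : α.vec.1 = symProd α.fst α.snd := coe_negProd α.pos_add_pos
  rw [h, symProd_apply]
  rfl

/-- The powers of root vectors which generate `I(λ)` annihilate the product of minors. -/
theorem matDer_iterate_of_mem_rootPowers {f : PosRoot n → nMinus n} (hf : IsRootVectors f)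
    {m : Fin n → ℕ} {r : SymMinus n} (hr : r ∈ rootPowers f m) :
    ∃ (x : nMinus n) (N : ℕ), r = SymmetricAlgebra.ι ℂ (nMinus n) x ^ N ∧
      ((matDer (x : Sp n))^[N]) (minorProd m) = 0 := by
  have hcol : ∀ α : PosRoot n, ∃ c : ℂ, ∀ a b, (f α).1.1 a b = c * α.vec.1.1 a b := fun α => by
    obtain ⟨c, -, hc⟩ := exists_smul_vec hf α
    exact ⟨c, fun a b => by rw [hc]; rfl⟩
  rcases hr with ⟨α, j, hj, hαj, rfl⟩ | ⟨α, i, hi, rfl⟩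
  · obtain ⟨c, hc⟩ := hcol α
    have hle := α.2.1
    have hfst : α.fst = Sum.inl ⟨j + 1, hj⟩ := by
      rw [PosRoot.fst, dif_pos (by omega)]
      simp only [hαj]
    have hne : (⟨j + 1, hj⟩ : Fin n) ≠ α.1.1 := fun e => by
      have := congrArg Fin.val e
      simp only at this
      omega
    have key := matDer_minor_of_single (Y := (f α : Sp n)) (i := α.1.1) (a := α.fst) (r := -c)
      (fun l b => by
        rw [hc, vec_apply, hfst]
        simp only [Sum.swap_inl, reduceCtorEq, if_false, ite_self, add_zero, Sum.inl.injEq]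
        split_ifs <;> simp)
      (fun b => by
        rw [hc, vec_apply, hfst]
        simp [hne])
    -- `minor k` involves `x_i` but not `x_{j+1}` exactly when `i ≤ k ≤ j`, which produces the
    -- exponent.
    refine ⟨f α, _, rfl, matDer_iterate_minorProd _ m (fun k => (key k).1) fun k hk => ?_⟩
    by_cases hik : k < α.1.1
    · exact (key k).2.1 hik
    · refine (key k).2.2 _ hfst hne ?_
      rw [Finset.mem_Icc, not_and] at hk
      have := hk (not_lt.1 hik)
      rw [Fin.le_def] at this ⊢
      simp only
      omega
  · obtain ⟨c, hc⟩ := hcol α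
    obtain ⟨rfl, hi⟩ := hi
    have hfst : α.fst = Sum.inr α.1.1 := by
      have := α.1.1.2
      rw [PosRoot.fst, dif_neg (by omega)]
      congr 1
      exact Fin.ext (by simp only; omega)
    -- For a long root the two entries of `x_{i*} x_{i*}` fall on the same place `(i*, i)`, hence
    -- the factor `2`. As `x_{i*}` is in no minor, all minors with `i ≤ k` count.
    have key := matDer_minor_of_single (Y := (f α : Sp n)) (i := α.1.1) (a := α.fst)
      (r := -(2 * c))
      (fun l b => by
        rw [hc, vec_apply, hfst]
        simp only [Sum.swap_inr, Sum.inl.injEq, sgn]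
        split_ifs <;> ring)
      (fun b => by
        rw [hc, vec_apply, hfst]
        simp)
    refine ⟨f α, _, rfl, matDer_iterate_minorProd _ m (fun k => (key k).1) fun k hk => ?_⟩
    rw [Finset.mem_Ici] at hk
    exact (key k).2.1 (not_le.1 hk)

/-- The generators of `I(λ)` annihilate the class of the highest weight vector. -/
theorem grAct_rootPowers {V : Type*} [AddCommGroup V] [Module ℂ V] [LieRingModule (Sp n) V]
    [LieModule ℂ (Sp n) V] {m : Fin n → ℕ} {v : V} (hv : IsIrreducibleHighestWeight m v)
    {f : PosRoot n → nMinus n} (hf : IsRootVectors f) {r : SymMinus n} (hr : r ∈ rootPowers f m) :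
    grAct v r (grTop v) = 0 := by
  obtain ⟨x, N, rfl, hN⟩ := matDer_iterate_of_mem_rootPowers hf hr
  let _ : LieRingModule (Sp n) (MatPoly n) := LieRingModule.compLieHom (MatPoly n) (matRep n)
  let _ : LieModule ℂ (Sp n) (MatPoly n) := LieModule.compLieHom (MatPoly n) (matRep n)
  have hbr : ∀ (Y : Sp n) (p : MatPoly n), ⁅Y, p⁆ = matDer Y p := fun _ _ => rfl
  have hw : IsSingular m (minorProd m) :=
    ⟨fun e he => by
      rw [hbr, matDer_minorProd_of_upper (isUpper_of_mem_nPlus he), weight_eq_zero_of_mem_nPlus he,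
        zero_smul],
    fun H hH => by rw [hbr, matDer_minorProd_of_upper (isUpper_of_mem_cartan hH)]⟩
  have hact : ∀ N : ℕ, actList (List.replicate N x) (minorProd m) =
      ((matDer (x : Sp n))^[N]) (minorProd m) := fun N => by
    induction N with
    | zero => rfl
    | succ N ih =>
      rw [Function.iterate_succ_apply', ← ih]
      rfl
  have h0 := hv.actList_eq_zero hw (minorProd_ne_zero m) ((hact N).trans hN)
  have h := grAct_list_prod v (List.replicate N x)
  rw [List.map_replicate, List.prod_replicate] at h
  rw [h]
  have e : (Submodule.Quotient.mk ⟨actList (List.replicate N x) v, actList_mem_filt v _⟩ :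
      GrPiece n v (List.replicate N x).length) = 0 := by
    rw [Submodule.Quotient.mk_eq_zero]
    change actList (List.replicate N x) v ∈ filtPred n v _
    rw [h0]
    exact zero_mem _
  rw [e, map_zero]

end PolynomialModule

end SymplecticPBW

end

open SymplecticPBW in
theorem theorem2p2 (n : ℕ) (hn : 1 ≤ n) (f : PosRoot n → nMinus n) (hf : IsRootVectors f) :
    (∀ (m : Fin n → ℕ) (V : Type*) [AddCommGroup V] [Module ℂ V] [LieRingModule (Sp n) V]
        [LieModule ℂ (Sp n) V] (v : V), IsIrreducibleHighestWeight m v →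
      Submodule.span ℂ {w : Gr n v | ∃ s ∈ latticePoints m, w = grAct v (mon f s) (grTop v)} = ⊤) ∧
    ∃ ord : MonomialOrder.{0, 0} (PosRoot n), ∀ (m : Fin n → ℕ) (s : PosRoot n →₀ ℕ),
      s ∉ latticePoints m →
        ∃ c : (PosRoot n →₀ ℕ) →₀ ℂ,
          (∀ t ∈ c.support, ord.toSyn t < ord.toSyn s ∧ t.degree = s.degree) ∧
          mon f s - c.sum (fun t a => a • mon f t) ∈ idealI f m :=
  ⟨fun _ _ _ _ _ _ _ hv => IsSingular.span_eq_top ⟨hv.lie_nPlus, hv.lie_cartan⟩ hf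
    fun _ hr => grAct_rootPowers hv hf hr, rootLex n, fun _ _ hs => hasStraightening hf hs⟩
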